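/- Let $(\Omega,\mathcal F,\mathbb P)$ be a complete probability space with a $\mathbb P$-preserving transformation $\vartheta$, let $(X,d)$ be a compact metric space with Borel $\sigma$-algebra $\mathcal B$, and let $\mathcal E\subset\Omega\times X$ be $\mathcal F\otimes\mathcal B$-measurable with all fibers $\mathcal E_\omega=\{x:(\omega,x)\in\mathcal E\}$ nonempty and compact. Let $T$ be a continuous bundle RDS on $\mathcal E$: maps $T_\omega:\mathcal E_\omega\to\mathcal E_{\vartheta\omega}$ such that $(\omega,x)\mapsto T_\omega x$ is measurable on $\mathcal E$ and $T_\omega$ is continuous for $\mathbb P$-almost every $\omega$. Put $\Theta(\omega,x)=(\vartheta\omega,T_\omega x)$ on $\mathcal E$, $T^0_\omega=\mathrm{id}$ and $T^n_\omega=T_{\vartheta^{n-1}\omega}\circ\dots\circ T_\omega$. Let $\mathcal I_{\mathbb P}(\mathcal E)$ be the set of $\Theta$-invariant probability measures $\mu$ on $\Omega\times X$ with marginal $\mathbb P$ on $\Omega$ and $\mu(\mathcal E)=1$; $T$ is called uniquely ergodic if $\mathcal I_{\mathbb P}(\mathcal E)$ consists of exactly one measure. A Borel set $E\subset X$ is called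 small if, for $\mathbb P$-almost every $\omega$, \[\lim_{n\to\infty}\frac1n\sup_{x\in\mathcal E_\omega}\sum_{i=0}^{n-1}1_E(T^i_\omega x)=0 .\] $T$ has the small boundary property (SBP) if for every $x\in X$ and every open $U\ni x$ there is a neighborhood $V\subset U$ of $x$ whose boundary $\partial V$ is small. Suppose that $\mathbb P$ is $\vartheta$-ergodic and that $T$ is uniquely ergodic, with $\mathcal I_{\mathbb P}(\mathcal E)=\{\mu\}$. Then $T$ has the SBP. Moreover, for every $x\in X$: $\mu(\Omega\times\{y:d(x,y)=r\})\neq0$ for at most countably many $r>0$; the sphere $\{y:d(x,y)=r\}$ fails to be small for at most countably many $r>0$; and for every $\varepsilon>0$ there is $r\in(0,\varepsilon)$ such that the ball $\{y:d(x,y)<r\}$ has small boundary. -/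

import Mathlib

open MeasureTheory Filter Topology Set

/-- A continuous bundle random dynamical system over `(Ω, P, ϑ)` with state space `X`:
a measurable set `graph ⊆ Ω × X` with nonempty compact fibres `E_ω`, and maps
`T_ω : E_ω → E_{ϑ ω}` which are jointly measurable in `(ω, x)` on `graph` and continuous for
`P`-almost every `ω`. -/
structure BundleRDS {Ω : Type*} [MeasurableSpace Ω] (X : Type*) [TopologicalSpace X]
    [MeasurableSpace X] (P : Measure Ω) (ϑ : Ω → Ω) where
  /-- the base transformation preserves `P` -/
  base_measurePreserving : MeasurePreserving ϑ P P
  /-- the bundle, as a subset of the product -/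
  graph : Set (Ω × X)
  measurableSet_graph : MeasurableSet graph
  fiber_nonempty : ∀ ω, {x : X | (ω, x) ∈ graph}.Nonempty
  fiber_isCompact : ∀ ω, IsCompact {x : X | (ω, x) ∈ graph}
  /-- the random transformation -/
  map : (ω : Ω) → {x : X | (ω, x) ∈ graph} → {x : X | (ϑ ω, x) ∈ graph}
  measurable_map : Measurable fun p : graph => (map p.1.1 ⟨p.1.2, p.2⟩ : X)
  continuous_map : ∀ᵐ ω ∂P, Continuous (map ω)

namespace BundleRDS

variable {Ω : Type*} [MeasurableSpace Ω] {X : Type*} [TopologicalSpace X] [MeasurableSpace X]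
  {P : Measure Ω} {ϑ : Ω → Ω}

/-- The fibre `E_ω`. -/
def fiber (T : BundleRDS X P ϑ) (ω : Ω) : Set X := {x : X | (ω, x) ∈ T.graph}

/-- The skew product `Θ (ω, x) = (ϑ ω, T_ω x)` on the bundle. -/
def skew (T : BundleRDS X P ϑ) (p : T.graph) : T.graph :=
  ⟨(ϑ p.1.1, T.map p.1.1 ⟨p.1.2, p.2⟩), (T.map p.1.1 ⟨p.1.2, p.2⟩).2⟩

/-- The cocycle `T^n_ω = T_{ϑ^{n-1} ω} ∘ ⋯ ∘ T_{ϑ ω} ∘ T_ω : E_ω → E_{ϑ^n ω}`. -/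
def iter (T : BundleRDS X P ϑ) : (n : ℕ) → (ω : Ω) → T.fiber ω → T.fiber (ϑ^[n] ω)
  | 0, _, x => x
  | n + 1, ω, x => T.iter n (ϑ ω) (T.map ω x)

theorem skew_iterate (T : BundleRDS X P ϑ) (n : ℕ) (ω : Ω) (x : T.fiber ω) :
    (T.skew^[n] ⟨(ω, x), x.2⟩).1 = (ϑ^[n] ω, (T.iter n ω x : X)) := by
  induction n generalizing ω with
  | zero => rfl
  | succ n ih => exact ih (ϑ ω) (T.map ω x)

theorem measurable_skew (T : BundleRDS X P ϑ) : Measurable T.skew :=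
  ((T.base_measurePreserving.measurable.comp
    (measurable_fst.comp measurable_subtype_coe)).prodMk T.measurable_map).subtype_mk

/-- The maximal number of visits to `E` before time `n` along an orbit that starts in `E_ω`:
`sup_{x ∈ E_ω} ∑_{i < n} 1_E (T^i_ω x)`. -/
noncomputable def maxVisits (T : BundleRDS X P ϑ) (E : Set X) (n : ℕ) (ω : Ω) : ℝ :=
  ⨆ x : T.fiber ω, ∑ i ∈ Finset.range n, E.indicator (fun _ => (1 : ℝ)) (T.iter i ω x : X)

/-- The `ω`-orbit capacity of `E` exists and equals `c`. -/
def HasOrbitCapacity (T : BundleRDS X P ϑ) (E : Set X) (ω : Ω) (c : ℝ) : Prop :=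
  Tendsto (fun n : ℕ => (1 / (n : ℝ)) * T.maxVisits E n ω) atTop (𝓝 c)

/-- `E` is `T`-small: its `ω`-orbit capacity is zero for `P`-almost every `ω`. -/
def IsSmall (T : BundleRDS X P ϑ) (E : Set X) : Prop :=
  ∀ᵐ ω ∂P, T.HasOrbitCapacity E ω 0

/-- The small boundary property. -/
def HasSBP (T : BundleRDS X P ϑ) : Prop :=
  ∀ (x : X) (U : Set X), IsOpen U → x ∈ U → ∃ V ∈ 𝓝 x, V ⊆ U ∧ T.IsSmall (frontier V)

/-- The `Θ`-invariant probability measures on `Ω × X` that have marginal `P` on `Ω` and are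
carried by the bundle. -/
def invariantMeasures (T : BundleRDS X P ϑ) : Set (Measure (Ω × X)) :=
  {μ | IsProbabilityMeasure μ ∧ μ.map Prod.fst = P ∧ μ T.graph = 1 ∧
    MeasurePreserving T.skew (μ.comap Subtype.val) (μ.comap Subtype.val)}

/-- `T` is uniquely ergodic: there is exactly one invariant measure over `P`. -/
def UniquelyErgodic (T : BundleRDS X P ϑ) : Prop :=
  ∃ μ, T.invariantMeasures = {μ}

end BundleRDS

/-!
Put `S_n F = ∑_{i < n} F ∘ Θ^i`. For a fibrewise continuous `F`, the limit of
`(1 / n) ∫ sup_{x ∈ E_ω} S_n F (ω, x) dP` is the integral of `F` against some invariant measure over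
`P`, hence `∫ F dμ`. Indeed the limit is a sublinear functional of `F`, and an invariant linear
functional that it dominates and that agrees with it at `F` (Hahn-Banach) is represented by a
measure on `Ω × X`, which domination and invariance place in `I_P(E)`. The supremum over the fibres
is `P`-measurable up to null sets because projections of measurable sets along a Polish space are.

A sphere `S` of zero `μ`-mass is closed and null, so some continuous `f` with `1_S ≤ f ≤ 1` has
small integral, and for some `m` the integral of `sup_x S_m f` is small compared with `m`. The
maximal ergodic theorem over the ergodic base bounds the Birkhoff sums of `sup_x S_m f` along almost
every orbit, and `m S_n f ≤ S_n (S_m f) + m ^ 2` turns this into a bound for the number of visits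
to `S`. Finally, the spheres about `x` are disjoint, so only countably many of them carry mass.
-/

open scoped ENNReal

section Projection

theorem exists_measure_image_le_add {α β : Type*} [MeasurableSpace α] (μ : Measure α)
    [IsFiniteMeasure μ] (f : β → α) (g : β → ℕ) (C : Set β) {δ : ℝ≥0∞} (hδ : δ ≠ 0) :
    ∃ N, μ (f '' C) ≤ μ (f '' (C ∩ {x | g x ≤ N})) + δ := by
  have hmono : Monotone fun N => f '' (C ∩ {x | g x ≤ N}) := fun M N hMN =>
    image_mono (inter_subset_inter_right _ fun x (hx : g x ≤ M) => hx.trans hMN)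
  have hunion : ⋃ N, f '' (C ∩ {x | g x ≤ N}) = f '' C := by
    rw [← image_iUnion, ← inter_iUnion, iUnion_eq_univ_iff.2 fun x => ⟨g x, le_refl (g x)⟩,
      inter_univ]
  have hsup : ⨆ N, μ (f '' (C ∩ {x | g x ≤ N})) = μ (f '' C) := by
    rw [← hunion, hmono.measure_iUnion]
  by_contra! hlt
  refine (ENNReal.lt_add_right (measure_ne_top μ (f '' C)) hδ).not_ge ?_
  rw [← hsup, ENNReal.iSup_add, hsup]
  exact iSup_le fun N => (hlt N).le

theorem exists_forall_measure_range_le_add {α : Type*} [MeasurableSpace α] (μ : Measure α)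
    [IsFiniteMeasure μ] (f : (ℕ → ℕ) → α) {ε : ℝ≥0∞} (hε : ε ≠ 0) :
    ∃ n : ℕ → ℕ, ∀ k, μ (range f) ≤ μ (f '' {x | ∀ i < k, x i ≤ n i}) + ε := by
  obtain ⟨δ, hδ, hδε⟩ := ENNReal.exists_pos_sum_of_countable' hε ℕ
  choose N hN using fun (C : Set (ℕ → ℕ)) k =>
    exists_measure_image_le_add μ f (fun x => x k) C (hδ k).ne'
  let C : ℕ → Set (ℕ → ℕ) := fun k => Nat.rec univ (fun k C => C ∩ {x | x k ≤ N C k}) k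
  have hC : ∀ k, C k = {x | ∀ i < k, x i ≤ N (C i) i} := by
    intro k
    induction k with
    | zero => simp [C]
    | succ k ih =>
      ext x
      rw [mem_ofPred_eq, Nat.forall_lt_succ_right, show C (k + 1) = C k ∩ {x | x k ≤ N (C k) k}
        from rfl, mem_inter_iff, Set.ext_iff.1 ih x, mem_ofPred_eq, mem_ofPred_eq]
  have hsum : ∀ k, μ (range f) ≤ μ (f '' C k) + ∑ i ∈ Finset.range k, δ i := by
    intro k
    induction k with
    | zero => simp [C]
    | succ k ih =>
      calc μ (range f) ≤ μ (f '' C k) + ∑ i ∈ Finset.range k, δ i := ih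
        _ ≤ μ (f '' C (k + 1)) + δ k + ∑ i ∈ Finset.range k, δ i := by gcongr; exact hN (C k) k
        _ = μ (f '' C (k + 1)) + ∑ i ∈ Finset.range (k + 1), δ i := by
          rw [Finset.sum_range_succ, add_assoc, add_comm (δ k)]
  refine ⟨fun k => N (C k) k, fun k => ?_⟩
  rw [← hC k]
  exact (hsum k).trans (by gcongr; exact (ENNReal.sum_le_tsum _).trans hδε.le)

theorem exists_forall_lt_le_subset_of_pi_Iic_subset {n : ℕ → ℕ} {U : Set (ℕ → ℕ)} (hU : IsOpen U)
    (h : univ.pi (fun i => Iic (n i)) ⊆ U) : ∃ k, {x | ∀ i < k, x i ≤ n i} ⊆ U := by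
  let : MetricSpace (ℕ → ℕ) := PiNat.metricSpaceNatNat
  have hcompact : IsCompact (univ.pi fun i => Iic (n i)) :=
    isCompact_univ_pi fun i => (finite_Iic (n i)).isCompact
  obtain ⟨r, hr, hthick⟩ := hcompact.exists_thickening_subset_open hU h
  obtain ⟨k, hk⟩ := exists_pow_lt_of_lt_one hr (by norm_num : (1 / 2 : ℝ) < 1)
  refine ⟨k, fun x hx => hthick (Metric.mem_thickening_iff.2
    ⟨fun i => min (x i) (n i), fun i _ => min_le_right (x i) (n i), lt_of_le_of_lt ?_ hk⟩)⟩
  rw [← PiNat.mem_cylinder_iff_dist_le, PiNat.mem_cylinder_iff]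
  exact fun i hi => (min_eq_left (hx i hi)).symm

theorem exists_isCompact_measure_le_add_of_analyticSet {α : Type*} [TopologicalSpace α]
    [MeasurableSpace α] (μ : Measure α) [IsFiniteMeasure μ] [μ.OuterRegular] {s : Set α}
    (hs : AnalyticSet s) {ε : ℝ≥0∞} (hε : ε ≠ 0) :
    ∃ K ⊆ s, IsCompact K ∧ μ s ≤ μ K + ε := by
  rw [AnalyticSet] at hs
  obtain rfl | ⟨f, hf, rfl⟩ := hs
  · exact ⟨∅, subset_rfl, isCompact_empty, by simp⟩
  obtain ⟨n, hn⟩ := exists_forall_measure_range_le_add μ f hε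
  refine ⟨f '' univ.pi fun i => Iic (n i), image_subset_range _ _,
    (isCompact_univ_pi fun i => (finite_Iic (n i)).isCompact).image hf, ?_⟩
  rw [(f '' _).measure_eq_iInf_isOpen μ]
  simp only [ENNReal.iInf_add]
  refine le_iInf fun U => le_iInf fun hKU => le_iInf fun hU => ?_
  obtain ⟨k, hk⟩ := exists_forall_lt_le_subset_of_pi_Iic_subset (hU.preimage hf)
    (image_subset_iff.1 hKU)
  exact (hn k).trans (by gcongr; exact image_subset_iff.2 hk)

theorem nullMeasurableSet_of_analyticSet {α : Type*} [TopologicalSpace α] [T2Space α]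
    [MeasurableSpace α] [OpensMeasurableSpace α] (μ : Measure α) [IsFiniteMeasure μ]
    [μ.OuterRegular] {s : Set α} (hs : AnalyticSet s) : NullMeasurableSet s μ := by
  choose K hKs hK hμK using fun n : ℕ =>
    exists_isCompact_measure_le_add_of_analyticSet μ hs (ε := (n : ℝ≥0∞)⁻¹)
      (ENNReal.inv_ne_zero.2 (by finiteness))
  have hmeas : MeasurableSet (⋃ n, K n) := MeasurableSet.iUnion fun n => (hK n).measurableSet
  have hsub : ⋃ n, K n ⊆ s := iUnion_subset hKs
  have hle : μ s ≤ μ (⋃ n, K n) := by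
    refine ENNReal.le_of_forall_pos_le_add fun ε hε _ => ?_
    obtain ⟨n, hn⟩ := ENNReal.exists_inv_nat_lt (ENNReal.coe_pos.2 hε).ne'
    exact (hμK n).trans (add_le_add (measure_mono (subset_iUnion K n)) hn.le)
  have hdiff : μ (s \ ⋃ n, K n) = 0 := by
    rw [measure_sdiff hsub hmeas.nullMeasurableSet (measure_ne_top _ _)]
    exact tsub_eq_zero_of_le hle
  rw [← union_sdiff_cancel hsub]
  exact hmeas.nullMeasurableSet.union (NullMeasurableSet.of_null hdiff)

-- Only countably many sets `A ⊆ Ω` enter the construction of `S`; `φ` records membership in them.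
theorem exists_measurable_cantor_eq_preimage_prodMap {Ω X : Type*} [MeasurableSpace Ω]
    [MeasurableSpace X] {S : Set (Ω × X)} (hS : MeasurableSet S) :
    ∃ (φ : Ω → ℕ → Bool) (S' : Set ((ℕ → Bool) × X)), Measurable φ ∧ MeasurableSet S' ∧
      S = Prod.map φ id ⁻¹' S' := by
  classical
  rw [← generateFrom_prod] at hS
  induction S, hS using MeasurableSpace.generateFrom_induction with
  | hC t ht _ =>
    obtain ⟨A, hA, B, hB, rfl⟩ := ht
    refine ⟨fun ω _ => decide (ω ∈ A), {z : ℕ → Bool | z 0 = true} ×ˢ B, ?_, ?_, ?_⟩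
    · exact measurable_pi_lambda _ fun _ => measurable_to_bool (by simpa [preimage] using hA)
    · exact (measurableSet_eq_fun (measurable_pi_apply 0) measurable_const).prod hB
    · ext ⟨ω, x⟩; simp
  | empty => exact ⟨fun _ _ => true, ∅, measurable_const, .empty, by simp⟩
  | compl t _ ih =>
    obtain ⟨φ, S', hφ, hS', rfl⟩ := ih
    exact ⟨φ, S'ᶜ, hφ, hS'.compl, rfl⟩
  | iUnion s _ ih =>
    choose φ S' hφ hS' h using ih
    refine ⟨fun ω k => φ k.unpair.1 ω k.unpair.2,
      ⋃ n, (fun p : (ℕ → Bool) × X => ((fun k => p.1 (Nat.pair n k)), p.2)) ⁻¹' S' n,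
      measurable_pi_lambda _ fun k => (measurable_pi_apply _).comp (hφ _),
      MeasurableSet.iUnion fun n => ?_, ?_⟩
    · refine Measurable.prodMk (measurable_pi_lambda _ fun k => ?_) measurable_snd (hS' n)
      exact (measurable_pi_apply _).comp measurable_fst
    · rw [preimage_iUnion]
      refine iUnion_congr fun n => (h n).trans ?_
      ext ⟨ω, x⟩
      simp

theorem nullMeasurableSet_image_fst {Ω X : Type*} [MeasurableSpace Ω] (P : Measure Ω)
    [IsFiniteMeasure P] [TopologicalSpace X] [PolishSpace X] [MeasurableSpace X] [BorelSpace X]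
    {S : Set (Ω × X)} (hS : MeasurableSet S) : NullMeasurableSet (Prod.fst '' S) P := by
  obtain ⟨φ, S', hφ, hS', rfl⟩ := exists_measurable_cantor_eq_preimage_prodMap hS
  have himage : Prod.fst '' (Prod.map φ id ⁻¹' S') = φ ⁻¹' (Prod.fst '' S') := by
    ext ω
    simp
  have : PolishSpace ((ℕ → Bool) × X) := { }
  rw [himage]
  exact (nullMeasurableSet_of_analyticSet (P.map φ)
    (hS'.analyticSet.image_of_continuous continuous_fst)).preimage
    (hφ.quasiMeasurePreserving P)

end Projection

theorem integral_comp_of_measurePreserving {α β : Type*} [MeasurableSpace α] [MeasurableSpace β]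
    {μ : Measure α} {ν : Measure β} {θ : α → β} (hθ : MeasurePreserving θ μ ν) {f : β → ℝ}
    (hf : AEStronglyMeasurable f ν) : ∫ x, f (θ x) ∂μ = ∫ y, f y ∂ν := by
  rw [← hθ.map_eq] at hf ⊢
  exact (integral_map hθ.aemeasurable hf).symm

section MaximalErgodic

variable {α : Type*}

/-- The maximum of `0` and the first `n` Birkhoff sums of `h` along `θ`, the quantity controlled by
the maximal ergodic inequality; the recursion reads the orbit from its second point on. -/
noncomputable def birkhoffMax (θ : α → α) (h : α → ℝ) : ℕ → α → ℝ
  | 0, _ => 0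
  | n + 1, x => max 0 (h x + birkhoffMax θ h n (θ x))

theorem birkhoffMax_nonneg (θ : α → α) (h : α → ℝ) (n : ℕ) (x : α) : 0 ≤ birkhoffMax θ h n x := by
  cases n <;> simp [birkhoffMax]

theorem birkhoffMax_le_succ (θ : α → α) (h : α → ℝ) (n : ℕ) (x : α) :
    birkhoffMax θ h n x ≤ birkhoffMax θ h (n + 1) x := by
  induction n generalizing x with
  | zero => exact birkhoffMax_nonneg θ h 1 x
  | succ n ih => exact max_le_max le_rfl (by gcongr; exact ih _)

theorem birkhoffSum_le_birkhoffMax (θ : α → α) (h : α → ℝ) (n : ℕ) (x : α) :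
    birkhoffSum θ h n x ≤ birkhoffMax θ h n x := by
  induction n generalizing x with
  | zero => simp [birkhoffMax]
  | succ n ih =>
    rw [birkhoffSum_succ']
    exact le_max_of_le_right (by gcongr; exact ih _)

theorem birkhoffMax_succ_sub_birkhoffMax_comp (θ : α → α) (h : α → ℝ) (n : ℕ) (x : α) :
    birkhoffMax θ h (n + 1) x - birkhoffMax θ h n (θ x) =
      max (-birkhoffMax θ h n (θ x)) (h x) := by
  rw [birkhoffMax, ← max_sub_sub_right, zero_sub, add_sub_cancel_right]

theorem bddAbove_range_birkhoffMax_comp_iff (θ : α → α) (h : α → ℝ) (x : α) :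
    BddAbove (range fun n => birkhoffMax θ h n (θ x)) ↔
      BddAbove (range fun n => birkhoffMax θ h n x) := by
  constructor
  · rintro ⟨M, hM⟩
    refine ⟨max 0 (h x + M), forall_mem_range.2 fun n => ?_⟩
    exact (birkhoffMax_le_succ θ h n x).trans
      (max_le_max le_rfl (by gcongr; exact hM (mem_range_self n)))
  · rintro ⟨M, hM⟩
    refine ⟨M - h x, forall_mem_range.2 fun n => ?_⟩
    exact le_sub_iff_add_le'.2 ((le_max_right _ _).trans (hM (mem_range_self (n + 1))))

variable [MeasurableSpace α] {μ : Measure α} {θ : α → α} {h : α → ℝ}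

theorem measurable_birkhoffMax (hθ : Measurable θ) (hh : Measurable h) (n : ℕ) :
    Measurable (birkhoffMax θ h n) := by
  induction n with
  | zero => exact measurable_const
  | succ n ih => exact measurable_const.max (hh.add (ih.comp hθ))

theorem integrable_birkhoffMax (hθ : MeasurePreserving θ μ μ) (hh : Integrable h μ) (n : ℕ) :
    Integrable (birkhoffMax θ h n) μ := by
  induction n with
  | zero => exact integrable_zero _ _ _
  | succ n ih =>
    exact (hh.add (hθ.integrable_comp_of_integrable ih)).pos_part.congr
      (ae_of_all _ fun x => max_comm _ _)

theorem tendsto_integral_birkhoffMax_succ_sub (hθ : MeasurePreserving θ μ μ)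
    (hh : Integrable h μ)
    (hunbdd : ∀ᵐ x ∂μ, ¬ BddAbove (range fun n => birkhoffMax θ h n x)) :
    Tendsto (fun n => ∫ x, (birkhoffMax θ h (n + 1) x - birkhoffMax θ h n (θ x)) ∂μ) atTop
      (𝓝 (∫ x, h x ∂μ)) := by
  refine tendsto_integral_of_dominated_convergence (fun x => |h x|) (fun n => ?_) hh.abs
    (fun n => ae_of_all _ fun x => ?_) ?_
  · exact ((integrable_birkhoffMax hθ hh (n + 1)).sub
      (hθ.integrable_comp_of_integrable (integrable_birkhoffMax hθ hh n))).aestronglyMeasurable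
  · have hnonneg := birkhoffMax_nonneg θ h n (θ x)
    rw [birkhoffMax_succ_sub_birkhoffMax_comp]
    exact abs_le.2 ⟨(neg_abs_le _).trans (le_max_right _ _),
      max_le (by linarith [abs_nonneg (h x)]) (le_abs_self _)⟩
  · filter_upwards [hθ.quasiMeasurePreserving.ae hunbdd] with x hx
    have htop : Tendsto (fun n => birkhoffMax θ h n (θ x)) atTop atTop :=
      tendsto_atTop_atTop_of_monotone'
        (monotone_nat_of_le_succ fun n => birkhoffMax_le_succ θ h n (θ x)) hx
    refine tendsto_const_nhds.congr' ?_
    filter_upwards [htop.eventually_ge_atTop (-h x)] with n hn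
    rw [birkhoffMax_succ_sub_birkhoffMax_comp, max_eq_right (by linarith)]

theorem integral_nonneg_of_ae_not_bddAbove_birkhoffMax (hθ : MeasurePreserving θ μ μ)
    (hh : Integrable h μ)
    (hunbdd : ∀ᵐ x ∂μ, ¬ BddAbove (range fun n => birkhoffMax θ h n x)) :
    0 ≤ ∫ x, h x ∂μ := by
  refine ge_of_tendsto' (tendsto_integral_birkhoffMax_succ_sub hθ hh hunbdd) fun n => ?_
  have hint := integrable_birkhoffMax hθ hh
  have hint_comp : Integrable (fun x => birkhoffMax θ h n (θ x)) μ :=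
    hθ.integrable_comp_of_integrable (hint n)
  rw [integral_sub (hint _) hint_comp,
    integral_comp_of_measurePreserving hθ (hint n).aestronglyMeasurable, sub_nonneg]
  exact integral_mono (hint _) (hint _) (birkhoffMax_le_succ θ h n)

theorem ae_bddAbove_range_birkhoffMax [IsProbabilityMeasure μ] (hθ : Ergodic θ μ)
    (hm : Measurable h) (hh : Integrable h μ) (hneg : ∫ x, h x ∂μ < 0) :
    ∀ᵐ x ∂μ, BddAbove (range fun n => birkhoffMax θ h n x) := by
  have hmeas : MeasurableSet {x | BddAbove (range fun n => birkhoffMax θ h n x)} :=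
    measurableSet_bddAbove_range fun n => measurable_birkhoffMax hθ.measurable hm n
  obtain hzero | hone := hθ.toPreErgodic.prob_eq_zero_or_one hmeas
    (ext fun x => bddAbove_range_birkhoffMax_comp_iff θ h x)
  · exact absurd (integral_nonneg_of_ae_not_bddAbove_birkhoffMax hθ.toMeasurePreserving hh
      (measure_eq_zero_iff_ae_notMem.1 hzero)) hneg.not_ge
  · exact (mem_ae_iff_prob_eq_one hmeas).2 hone

theorem ae_exists_forall_birkhoffSum_le [IsProbabilityMeasure μ] (hθ : Ergodic θ μ)
    (hh : Integrable h μ) {c : ℝ} (hc : ∫ x, h x ∂μ < c) :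
    ∀ᵐ x ∂μ, ∃ M, ∀ n : ℕ, birkhoffSum θ h n x ≤ M + n * c := by
  obtain ⟨g, hg, hhg⟩ := hh.aestronglyMeasurable
  have hgi : Integrable g μ := hh.congr hhg
  have hneg : ∫ x, (g x - c) ∂μ < 0 := by
    rw [integral_sub hgi (integrable_const c), ← integral_congr_ae hhg]
    simpa using hc
  filter_upwards [ae_bddAbove_range_birkhoffMax hθ (hg.measurable.sub_const c)
    (hgi.sub (integrable_const c)) hneg,
    ae_all_iff.2 fun n => hθ.quasiMeasurePreserving.birkhoffSum_ae_eq_of_ae_eq hhg n]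
    with x hx hsum
  obtain ⟨M, hM⟩ := hx
  refine ⟨M, fun n => ?_⟩
  have hle : birkhoffSum θ (fun y => g y - c) n x ≤ M :=
    (birkhoffSum_le_birkhoffMax θ _ n x).trans (hM (mem_range_self n))
  have heq : birkhoffSum θ (fun y => g y - c) n x = birkhoffSum θ g n x - n * c := by
    simp [birkhoffSum, Finset.sum_sub_distrib]
  linarith [hsum n]

end MaximalErgodic

section Disintegration

open ProbabilityTheory

theorem isRatStieltjesPoint_of_tendsto {Ω : Type*} {h : Ω → ℚ → ℝ} {ω : Ω} (hmono : Monotone (h ω))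
    (htop : Tendsto (fun n : ℕ => h ω n) atTop (𝓝 1))
    (hbot : Tendsto (fun n : ℕ => h ω (-n)) atTop (𝓝 0))
    (hright : ∀ t : ℚ, Tendsto (fun n : ℕ => h ω (t + 1 / (n + 1))) atTop (𝓝 (h ω t))) :
    IsRatStieltjesPoint h ω where
  mono := hmono
  tendsto_atTop_one :=
    (tendsto_iff_tendsto_subseq_of_monotone hmono tendsto_natCast_atTop_atTop).2 htop
  tendsto_atBot_zero := by
    have hanti : Antitone fun q : ℚ => h ω (-q) := fun q r hqr => hmono (neg_le_neg hqr)
    simpa [Function.comp_def] using ((tendsto_iff_tendsto_subseq_of_antitone hanti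
      (tendsto_natCast_atTop_atTop (R := ℚ))).2 hbot).comp tendsto_neg_atBot_atTop
  iInf_rat_gt_eq t := by
    have hbdd : BddBelow (range fun r : Ioi t => h ω r) :=
      ⟨h ω t, forall_mem_range.2 fun r => hmono r.2.le⟩
    refine le_antisymm (ge_of_tendsto' (hright t) fun n => ?_) (le_ciInf fun r => hmono r.2.le)
    exact ciInf_le hbdd ⟨_, lt_add_of_pos_right t (by positivity)⟩

theorem tendsto_cdf_add_one_div (τ : Measure ℝ) (t : ℝ) :
    Tendsto (fun n : ℕ => cdf τ (t + 1 / (n + 1))) atTop (𝓝 (cdf τ t)) := by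
  refine ((cdf τ).right_continuous t).tendsto.comp
    (tendsto_nhdsWithin_iff.2 ⟨?_, Eventually.of_forall fun n => ?_⟩)
  · simpa using (tendsto_one_div_add_atTop_nhds_zero_nat (𝕜 := ℝ)).const_add t
  · exact (le_add_of_nonneg_right (by positivity) : t ≤ t + 1 / ((n : ℝ) + 1))

variable {Ω : Type*} [MeasurableSpace Ω] {P : Measure Ω}

theorem exists_setIntegral_eq_of_additive [IsFiniteMeasure P] {m : Set Ω → ℝ}
    (hle : ∀ A, MeasurableSet A → |m A| ≤ P.real A)
    (hadd : ∀ A B, MeasurableSet A → MeasurableSet B → Disjoint A B → m (A ∪ B) = m A + m B) :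
    ∃ h : Ω → ℝ, Measurable h ∧ Integrable h P ∧
      ∀ A, MeasurableSet A → ∫ ω in A, h ω ∂P = m A := by
  classical
  have hle' : ∀ A, ‖if MeasurableSet A then m A else 0‖ₑ ≤ P A := fun A => by
    split_ifs with hA
    · rw [← ofReal_measureReal, Real.enorm_eq_ofReal_abs]
      exact ENNReal.ofReal_le_ofReal (hle A hA)
    · simp
  let s : SignedMeasure Ω := VectorMeasure.of_additive_of_le_measure
    (fun A => if MeasurableSet A then m A else 0) hle'
    (fun A B hA hB hAB => by simp only [hA, hB, hA.union hB, if_true, hadd A B hA hB hAB])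
    (fun A hA => if_neg hA)
  have hs : ∀ A, MeasurableSet A → s A = m A := fun A hA => if_pos hA
  have hac : s ≪ᵥ P.toENNRealVectorMeasure := VectorMeasure.AbsolutelyContinuous.mk fun A hA hPA =>
    by
      rw [Measure.toENNRealVectorMeasure_apply_measurable hA] at hPA
      exact enorm_eq_zero.1 (le_antisymm ((hle' A).trans hPA.le) bot_le)
  refine ⟨s.rnDeriv P, s.measurable_rnDeriv P, s.integrable_rnDeriv P, fun A hA => ?_⟩
  rw [← hs A hA, ← withDensityᵥ_apply (s.integrable_rnDeriv P) hA,
    s.withDensityᵥ_rnDeriv_eq P hac]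

theorem ae_isRatStieltjesPoint [IsProbabilityMeasure P] {τ : Measure ℝ} [IsProbabilityMeasure τ]
    {h : Ω → ℚ → ℝ} (hint : ∀ q, Integrable (fun ω => h ω q) P)
    (hmono : ∀ᵐ ω ∂P, Monotone (h ω)) (hnonneg : ∀ᵐ ω ∂P, ∀ q, 0 ≤ h ω q)
    (hle : ∀ᵐ ω ∂P, ∀ q, h ω q ≤ 1) (hτ : ∀ q : ℚ, ∫ ω, h ω q ∂P = cdf τ q) :
    ∀ᵐ ω ∂P, IsRatStieltjesPoint h ω := by
  have htop : ∀ᵐ ω ∂P, Tendsto (fun n : ℕ => h ω n) atTop (𝓝 1) := by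
    refine tendsto_of_integral_tendsto_of_monotone (fun n => hint n) (integrable_const 1) ?_
      (hmono.mono fun ω hω m n hmn => hω (by exact_mod_cast hmn))
      (hle.mono fun ω hω n => hω n)
    simpa [hτ, Function.comp_def] using
      (tendsto_cdf_atTop τ).comp tendsto_natCast_atTop_atTop
  have hbot : ∀ᵐ ω ∂P, Tendsto (fun n : ℕ => h ω (-n)) atTop (𝓝 0) := by
    refine tendsto_of_integral_tendsto_of_antitone (fun n => hint (-n)) (integrable_zero _ _ _) ?_
      (hmono.mono fun ω hω m n hmn => hω (by simpa using hmn))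
      (hnonneg.mono fun ω hω n => hω _)
    simpa [hτ, Function.comp_def] using (tendsto_cdf_atBot τ).comp
      (tendsto_neg_atTop_atBot.comp tendsto_natCast_atTop_atTop)
  have hright : ∀ᵐ ω ∂P, ∀ t : ℚ,
      Tendsto (fun n : ℕ => h ω (t + 1 / (n + 1))) atTop (𝓝 (h ω t)) := by
    refine ae_all_iff.2 fun t => tendsto_of_integral_tendsto_of_antitone (fun n => hint _) (hint t)
      ?_ (hmono.mono fun ω hω m n hmn => hω (by gcongr))
      (hmono.mono fun ω hω n => hω (le_add_of_nonneg_right (by positivity)))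
    simpa [hτ] using tendsto_cdf_add_one_div τ t
  filter_upwards [hmono, htop, hbot, hright] with ω hmono htop hbot hright
  exact isRatStieltjesPoint_of_tendsto hmono htop hbot hright

theorem exists_isMarkovKernel_Iic_eq {h : Ω → ℚ → ℝ} (hm : Measurable h)
    (hh : ∀ᵐ ω ∂P, IsRatStieltjesPoint h ω) :
    ∃ κ : Kernel Ω ℝ, IsMarkovKernel κ ∧
      ∀ᵐ ω ∂P, ∀ q : ℚ, κ ω (Iic (q : ℝ)) = ENNReal.ofReal (h ω q) := by
  refine ⟨⟨fun ω => (stieltjesOfMeasurableRat h hm ω).measure,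
    measurable_measure_stieltjesOfMeasurableRat hm⟩,
    ⟨fun ω => instIsProbabilityMeasure_stieltjesOfMeasurableRat hm ω⟩, ?_⟩
  filter_upwards [hh] with ω hω q
  rw [Kernel.coe_mk, measure_stieltjesOfMeasurableRat_Iic, stieltjesOfMeasurableRat_eq,
    toRatCDF_of_isRatStieltjesPoint hω]

theorem map_snd_restrict_apply {X : Type*} [MeasurableSpace X] (m : Measure (Ω × X)) (A : Set Ω)
    {B : Set X} (hB : MeasurableSet B) :
    (m.restrict (A ×ˢ univ)).map Prod.snd B = m (A ×ˢ B) := by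
  rw [Measure.map_apply measurable_snd hB, Measure.restrict_apply (measurable_snd hB),
    ← univ_prod, prod_inter_prod, univ_inter, inter_univ]

/-- A *random measure in weak form*: measures `ν A` on `X` that depend additively on the measurable
set `A ⊆ Ω` and have mass `P A`, like `B ↦ m (A ×ˢ B)` for a measure `m` on `Ω × X` with first
marginal `P`. -/
structure IsBimeasure {X : Type*} [MeasurableSpace X] (P : Measure Ω) (ν : Set Ω → Measure X) :
    Prop where
  apply_univ : ∀ A, MeasurableSet A → ν A univ = P A
  union : ∀ A B, MeasurableSet A → MeasurableSet B → Disjoint A B → ν (A ∪ B) = ν A + ν B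

namespace IsBimeasure

variable {X : Type*} [MeasurableSpace X] {ν : Set Ω → Measure X}

theorem isFiniteMeasure [IsFiniteMeasure P] (hν : IsBimeasure P ν) {A : Set Ω}
    (hA : MeasurableSet A) : IsFiniteMeasure (ν A) :=
  ⟨by rw [hν.apply_univ A hA]; exact measure_lt_top P A⟩

theorem measureReal_le [IsFiniteMeasure P] (hν : IsBimeasure P ν) {A : Set Ω}
    (hA : MeasurableSet A) (B : Set X) : (ν A).real B ≤ P.real A := by
  have := hν.isFiniteMeasure hA
  rw [measureReal_def P, ← hν.apply_univ A hA]
  exact measureReal_mono (subset_univ B)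

theorem map {Y : Type*} [MeasurableSpace Y] (hν : IsBimeasure P ν) {e : X → Y}
    (he : Measurable e) : IsBimeasure P fun A => (ν A).map e where
  apply_univ A hA := by rw [Measure.map_apply he .univ, preimage_univ, hν.apply_univ A hA]
  union A B hA hB hAB := by rw [hν.union A B hA hB hAB, Measure.map_add _ _ he]

theorem exists_setIntegral_eq [IsFiniteMeasure P] (hν : IsBimeasure P ν) (B : Set X) :
    ∃ h : Ω → ℝ, Measurable h ∧ Integrable h P ∧
      ∀ A, MeasurableSet A → ∫ ω in A, h ω ∂P = (ν A).real B := by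
  refine exists_setIntegral_eq_of_additive (fun A hA => ?_) fun A A' hA hA' hAA' => ?_
  · rw [abs_of_nonneg measureReal_nonneg]
    exact hν.measureReal_le hA B
  · have := hν.isFiniteMeasure hA
    have := hν.isFiniteMeasure hA'
    rw [hν.union A A' hA hA' hAA', measureReal_add_apply]

theorem ae_isRatStieltjesPoint [IsProbabilityMeasure P] {ν : Set Ω → Measure ℝ}
    (hν : IsBimeasure P ν) {h : Ω → ℚ → ℝ} (hint : ∀ q, Integrable (fun ω => h ω q) P)
    (hh : ∀ q : ℚ, ∀ A, MeasurableSet A → ∫ ω in A, h ω q ∂P = (ν A).real (Iic (q : ℝ))) :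
    ∀ᵐ ω ∂P, IsRatStieltjesPoint h ω := by
  have : IsProbabilityMeasure (ν univ) := ⟨by rw [hν.apply_univ univ .univ, measure_univ]⟩
  refine _root_.ae_isRatStieltjesPoint (τ := ν univ) hint ?_ ?_ ?_ fun q => ?_
  · refine ae_all_iff.2 fun q => ae_all_iff.2 fun r => ae_all_iff.2 fun hqr => ?_
    refine ae_le_of_forall_setIntegral_le (hint q) (hint r) fun A hA _ => ?_
    have := hν.isFiniteMeasure hA
    rw [hh q A hA, hh r A hA]
    exact measureReal_mono (Iic_subset_Iic.2 (by exact_mod_cast hqr))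
  · refine ae_all_iff.2 fun q => ae_le_of_forall_setIntegral_le (integrable_zero _ _ _) (hint q)
      fun A hA _ => ?_
    rw [hh q A hA, integral_zero]
    exact measureReal_nonneg
  · refine ae_all_iff.2 fun q => ae_le_of_forall_setIntegral_le (hint q) (integrable_const 1)
      fun A hA _ => ?_
    rw [hh q A hA]
    simpa using hν.measureReal_le hA _
  · rw [cdf_eq_real, ← hh q univ .univ, Measure.restrict_univ]

theorem exists_measure_prod_Iic_eq [IsProbabilityMeasure P] {ν : Set Ω → Measure ℝ}
    (hν : IsBimeasure P ν) :
    ∃ m : Measure (Ω × ℝ), ∀ A, MeasurableSet A →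
      m (A ×ˢ univ) = P A ∧ ∀ q : ℚ, m (A ×ˢ Iic (q : ℝ)) = ν A (Iic (q : ℝ)) := by
  choose h hmeas hint hh using fun q : ℚ => hν.exists_setIntegral_eq (Iic (q : ℝ))
  obtain ⟨κ, _, hκ⟩ := exists_isMarkovKernel_Iic_eq (measurable_pi_lambda (fun ω q => h q ω) hmeas)
    (hν.ae_isRatStieltjesPoint hint hh)
  refine ⟨P ⊗ₘ κ, fun A hA => ⟨?_, fun q => ?_⟩⟩
  · rw [Measure.compProd_apply_prod hA .univ]
    simp
  have hnonneg : 0 ≤ᵐ[P] h q := by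
    refine ae_le_of_forall_setIntegral_le (integrable_zero _ _ _) (hint q) fun A hA _ => ?_
    rw [hh q A hA]
    simp [measureReal_nonneg]
  have := hν.isFiniteMeasure hA
  calc (P ⊗ₘ κ) (A ×ˢ Iic (q : ℝ)) = ∫⁻ ω in A, κ ω (Iic (q : ℝ)) ∂P :=
        Measure.compProd_apply_prod hA measurableSet_Iic
    _ = ∫⁻ ω in A, ENNReal.ofReal (h q ω) ∂P :=
        lintegral_congr_ae (ae_restrict_of_ae (hκ.mono fun ω hω => hω q))
    _ = ENNReal.ofReal (∫ ω in A, h q ω ∂P) :=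
        (ofReal_integral_eq_lintegral_ofReal (hint q).integrableOn
          (ae_restrict_of_ae hnonneg)).symm
    _ = ν A (Iic (q : ℝ)) := by rw [hh q A hA, ofReal_measureReal]

theorem exists_measure_prod_eq_of_real [IsProbabilityMeasure P] {ν : Set Ω → Measure ℝ}
    (hν : IsBimeasure P ν) :
    ∃ m : Measure (Ω × ℝ), ∀ A, MeasurableSet A → ∀ B, MeasurableSet B →
      m (A ×ˢ B) = ν A B := by
  obtain ⟨m, hm⟩ := hν.exists_measure_prod_Iic_eq
  refine ⟨m, fun A hA B hB => ?_⟩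
  have hfin : IsFiniteMeasure ((m.restrict (A ×ˢ univ)).map Prod.snd) :=
    ⟨by rw [map_snd_restrict_apply m A .univ, (hm A hA).1]; exact measure_lt_top P A⟩
  have heq : (m.restrict (A ×ˢ univ)).map Prod.snd = ν A := by
    refine ext_of_generate_finite _ (BorelSpace.measurable_eq.trans
      Real.borel_eq_generateFrom_Iic_rat) Real.isPiSystem_Iic_rat ?_ ?_
    · simp only [mem_iUnion, mem_singleton_iff]
      rintro _ ⟨q, rfl⟩
      rw [map_snd_restrict_apply m A measurableSet_Iic, (hm A hA).2 q]
    · rw [map_snd_restrict_apply m A .univ, (hm A hA).1, hν.apply_univ A hA]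
  rw [← map_snd_restrict_apply m A hB, heq]

theorem exists_measure_prod_eq [StandardBorelSpace X] [IsProbabilityMeasure P]
    (hν : IsBimeasure P ν) :
    ∃ m : Measure (Ω × X), ∀ A, MeasurableSet A → ∀ B, MeasurableSet B → m (A ×ˢ B) = ν A B := by
  have he : MeasurableEmbedding (embeddingReal X) := measurableEmbedding_embeddingReal X
  obtain ⟨m, hm⟩ := (hν.map he.measurable).exists_measure_prod_eq_of_real
  refine ⟨m.comap (Prod.map id (embeddingReal X)), fun A hA B hB => ?_⟩
  rw [(MeasurableEmbedding.id.prodMap he).comap_apply, prodMap_image_prod, image_id,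
    hm A hA _ (he.measurableSet_image.2 hB), he.map_apply, preimage_image_eq _ he.injective]

end IsBimeasure

end Disintegration

section Riesz

theorem exists_isFiniteMeasure_integral_eq {X : Type*} [TopologicalSpace X] [CompactSpace X]
    [T2Space X] [MeasurableSpace X] [BorelSpace X] (Λ : C(X, ℝ) →ₗ[ℝ] ℝ)
    (hΛ : ∀ f, 0 ≤ f → 0 ≤ Λ f) :
    ∃ ν : Measure X, IsFiniteMeasure ν ∧ ∀ f : C(X, ℝ), ∫ x, f x ∂ν = Λ f := by
  let Λ' : CompactlySupportedContinuousMap X ℝ →ₚ[ℝ] ℝ := PositiveLinearMap.mk₀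
    { toFun := fun f => Λ f.toContinuousMap
      map_add' := fun f g => Λ.map_add _ _
      map_smul' := fun c f => Λ.map_smul _ _ } fun f hf => hΛ _ hf
  exact ⟨RealRMK.rieszMeasure Λ', inferInstance, fun f => RealRMK.integral_rieszMeasure Λ'
    (CompactlySupportedContinuousMap.continuousMapEquiv f)⟩

theorem integrable_of_isFiniteMeasure {X : Type*} [TopologicalSpace X] [CompactSpace X]
    [MeasurableSpace X] [OpensMeasurableSpace X] (μ : Measure X) [IsFiniteMeasure μ] (f : C(X, ℝ)) :
    Integrable f μ :=
  f.continuous.integrable_of_hasCompactSupport (HasCompactSupport.of_compactSpace _)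

variable {Ω : Type*} [MeasurableSpace Ω]

section Restrict

variable {E : Type*} [AddCommMonoid E]

/-- The simple function with value `c` on `A` and `0` elsewhere (the zero function when `A` is not
measurable), as a linear function of `c`. -/
noncomputable def restrictConst [Module ℝ E] (A : Set Ω) : E →ₗ[ℝ] SimpleFunc Ω E where
  toFun c := (SimpleFunc.const Ω c).restrict A
  map_add' c d := by
    by_cases hA : MeasurableSet A
    · ext1 ω
      simp only [SimpleFunc.coe_add, Pi.add_apply, SimpleFunc.restrict_apply _ hA]
      by_cases hω : ω ∈ A <;> simp [hω]
    · simp [SimpleFunc.restrict_of_not_measurable hA]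
  map_smul' r c := by
    by_cases hA : MeasurableSet A
    · ext1 ω
      simp only [SimpleFunc.restrict_apply _ hA]
      by_cases hω : ω ∈ A <;> simp [hω, SimpleFunc.restrict_apply _ hA]
    · simp [SimpleFunc.restrict_of_not_measurable hA]

theorem restrictConst_apply [Module ℝ E] {A : Set Ω} (hA : MeasurableSet A) (c : E) (ω : Ω) :
    restrictConst A c ω = A.indicator (fun _ => c) ω :=
  SimpleFunc.restrict_apply _ hA ω

theorem restrictConst_of_not_measurableSet [Module ℝ E] {A : Set Ω} (hA : ¬MeasurableSet A)
    (c : E) : restrictConst A c = 0 :=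
  SimpleFunc.restrict_of_not_measurable hA

theorem restrictConst_eq_piecewise [Module ℝ E] {A : Set Ω} (hA : MeasurableSet A) (c : E) :
    restrictConst A c = (SimpleFunc.const Ω c).piecewise A hA (SimpleFunc.const Ω 0) :=
  dif_pos hA

theorem restrictConst_nonneg [Module ℝ E] [Preorder E] (A : Set Ω) {c : E} (hc : 0 ≤ c) :
    0 ≤ restrictConst A c := by
  by_cases hA : MeasurableSet A
  · intro ω
    rw [restrictConst_apply hA]
    exact indicator_nonneg (fun _ _ => hc) ω
  · rw [restrictConst_of_not_measurableSet hA]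

theorem restrictConst_union [Module ℝ E] (c : E) {A B : Set Ω} (hA : MeasurableSet A)
    (hB : MeasurableSet B) (hAB : Disjoint A B) :
    restrictConst (A ∪ B) c = restrictConst A c + restrictConst B c := by
  ext1 ω
  rw [SimpleFunc.coe_add, Pi.add_apply, restrictConst_apply (hA.union hB), restrictConst_apply hA,
    restrictConst_apply hB, indicator_union_of_disjoint hAB]

end Restrict

theorem integral_restrictConst {X : Type*} [TopologicalSpace X] [MeasurableSpace X]
    [OpensMeasurableSpace X] (m : Measure (Ω × X)) {A : Set Ω} (hA : MeasurableSet A)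
    (f : C(X, ℝ)) :
    ∫ p, restrictConst A f p.1 p.2 ∂m = ∫ x, f x ∂(m.restrict (A ×ˢ univ)).map Prod.snd := by
  rw [integral_map measurable_snd.aemeasurable f.continuous.measurable.aestronglyMeasurable,
    ← integral_indicator (hA.prod .univ)]
  congr 1 with p
  by_cases hp : p.1 ∈ A <;> simp [restrictConst_apply hA, hp]

theorem measurable_simpleFunc_apply {X : Type*} [TopologicalSpace X] [MeasurableSpace X]
    [OpensMeasurableSpace X] (s : SimpleFunc Ω C(X, ℝ)) :
    Measurable fun p : Ω × X => s p.1 p.2 :=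
  (s.comp Prod.fst measurable_fst).measurable_bind (fun f (p : Ω × X) => f p.2)
    fun f => f.continuous.measurable.comp measurable_snd

theorem ext_of_forall_integral_simpleFunc_eq {X : Type*} [TopologicalSpace X]
    [HasOuterApproxClosed X] [MeasurableSpace X] [BorelSpace X] {m m' : Measure (Ω × X)}
    [IsFiniteMeasure m] [IsFiniteMeasure m']
    (h : ∀ s : SimpleFunc Ω C(X, ℝ), ∫ p, s p.1 p.2 ∂m = ∫ p, s p.1 p.2 ∂m') : m = m' := by
  refine Measure.ext_prod fun {A B} hA hB => ?_
  have hAB : (m.restrict (A ×ˢ univ)).map Prod.snd = (m'.restrict (A ×ˢ univ)).map Prod.snd := by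
    refine ext_of_forall_integral_eq_of_IsFiniteMeasure fun f => ?_
    exact (integral_restrictConst m hA f.toContinuousMap).symm.trans
      ((h _).trans (integral_restrictConst m' hA f.toContinuousMap))
  rw [← map_snd_restrict_apply m A hB, hAB, map_snd_restrict_apply m' A hB]

variable {X : Type*} [MetricSpace X] [CompactSpace X] [MeasurableSpace X] [BorelSpace X]
  {P : Measure Ω}

/-- A positive linear functional on simple functions with values in `C(X, ℝ)` whose value on the
indicator function of `A ⊆ Ω` is `P A`: what integration against a measure on `Ω × X` with first
marginal `P` is. -/
structure IsPositiveOver (P : Measure Ω) (L : SimpleFunc Ω C(X, ℝ) →ₗ[ℝ] ℝ) : Prop where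
  nonneg : ∀ s, 0 ≤ s → 0 ≤ L s
  apply_one : ∀ A, MeasurableSet A → L (restrictConst A 1) = P.real A

theorem IsPositiveOver.exists_isBimeasure [IsFiniteMeasure P] {L : SimpleFunc Ω C(X, ℝ) →ₗ[ℝ] ℝ}
    (hL : IsPositiveOver P L) :
    ∃ ν : Set Ω → Measure X, IsBimeasure P ν ∧
      ∀ A (f : C(X, ℝ)), ∫ x, f x ∂ν A = L (restrictConst A f) := by
  have hpos : ∀ A (f : C(X, ℝ)), 0 ≤ f → 0 ≤ (L ∘ₗ restrictConst A) f := fun A f hf =>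
    hL.nonneg _ (restrictConst_nonneg A hf)
  choose ν hfin hν using fun A => exists_isFiniteMeasure_integral_eq _ (hpos A)
  refine ⟨ν, ⟨fun A hA => ?_, fun A B hA hB hAB => ?_⟩, hν⟩
  · have hone := (hν A 1).trans (hL.apply_one A hA)
    simp only [ContinuousMap.one_apply, integral_const, smul_eq_mul, mul_one] at hone
    rw [← ofReal_measureReal (μ := ν A), hone, ofReal_measureReal]
  · refine ext_of_forall_integral_eq_of_IsFiniteMeasure fun f => ?_
    change ∫ x, f.toContinuousMap x ∂_ = ∫ x, f.toContinuousMap x ∂_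
    rw [integral_add_measure (integrable_of_isFiniteMeasure _ _)
      (integrable_of_isFiniteMeasure _ _), hν, hν, hν]
    simp only [LinearMap.comp_apply, restrictConst_union _ hA hB hAB, map_add]

theorem integrable_simpleFunc_apply (m : Measure (Ω × X)) [IsFiniteMeasure m]
    (s : SimpleFunc Ω C(X, ℝ)) : Integrable (fun p : Ω × X => s p.1 p.2) m := by
  obtain ⟨C, hC⟩ := s.exists_forall_norm_le
  exact .of_bound (measurable_simpleFunc_apply s).aestronglyMeasurable C
    (Eventually.of_forall fun p => ((s p.1).norm_coe_le_norm p.2).trans (hC p.1))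

theorem IsPositiveOver.exists_measure_integral_eq [IsProbabilityMeasure P]
    {L : SimpleFunc Ω C(X, ℝ) →ₗ[ℝ] ℝ} (hL : IsPositiveOver P L) :
    ∃ m : Measure (Ω × X), m.map Prod.fst = P ∧ ∀ s, ∫ p, s p.1 p.2 ∂m = L s := by
  obtain ⟨ν, hν, hνL⟩ := hL.exists_isBimeasure
  obtain ⟨m, hm⟩ := hν.exists_measure_prod_eq
  have hfst : m.map Prod.fst = P := Measure.ext fun A hA => by
    rw [Measure.map_apply measurable_fst hA, ← prod_univ, hm A hA univ .univ, hν.apply_univ A hA]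
  have hmprob : IsProbabilityMeasure m :=
    ⟨by rw [← univ_prod_univ, hm univ .univ univ .univ, hν.apply_univ univ .univ, measure_univ]⟩
  have hmν : ∀ A, MeasurableSet A → (m.restrict (A ×ˢ univ)).map Prod.snd = ν A := fun A hA =>
    Measure.ext fun B hB => by rw [map_snd_restrict_apply m A hB, hm A hA B hB]
  refine ⟨m, hfst, fun s => ?_⟩
  induction s using SimpleFunc.induction with
  | @const c A hA =>
    rw [← restrictConst_eq_piecewise, integral_restrictConst m hA, hmν A hA, hνL]
  | add _ hs ht =>
    simp only [SimpleFunc.coe_add, Pi.add_apply, ContinuousMap.add_apply, map_add]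
    rw [integral_add (integrable_simpleFunc_apply m _) (integrable_simpleFunc_apply m _), hs, ht]

end Riesz

section InvariantHahnBanach

variable {V : Type*} [AddCommGroup V] [Module ℝ V] {q : V → ℝ}

/-- A *sublinear functional*: the dominating functions of the Hahn-Banach theorem. -/
structure IsSublinear (q : V → ℝ) : Prop where
  smul : ∀ c : ℝ, 0 < c → ∀ v, q (c • v) = c * q v
  add_le : ∀ v w, q (v + w) ≤ q v + q w

namespace IsSublinear

theorem map_zero (hq : IsSublinear q) : q 0 = 0 := by
  have h := hq.smul 2 two_pos 0
  rw [smul_zero] at h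
  linarith

theorem neg_le (hq : IsSublinear q) (v : V) : -q (-v) ≤ q v := by
  have h := hq.add_le v (-v)
  rw [add_neg_cancel, hq.map_zero] at h
  linarith

theorem mul_le_apply_smul (hq : IsSublinear q) (c : ℝ) (v : V) : c * q v ≤ q (c • v) := by
  rcases lt_trichotomy c 0 with hc | rfl | hc
  · have h := hq.neg_le (c • v)
    rw [← neg_smul, hq.smul (-c) (neg_pos.2 hc)] at h
    linarith
  · rw [zero_mul, zero_smul, hq.map_zero]
  · exact (hq.smul c hc v).ge

theorem exists_linear_le_of_apply_eq (hq : IsSublinear q) (v₀ : V) :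
    ∃ Λ : V →ₗ[ℝ] ℝ, Λ v₀ = q v₀ ∧ ∀ v, Λ v ≤ q v := by
  have hsmul : ∀ c : ℝ, c • v₀ = 0 → c • q v₀ = 0 := fun c hc => by
    rcases smul_eq_zero.1 hc with rfl | rfl
    · exact zero_smul ℝ _
    · rw [hq.map_zero, smul_zero]
  let f : V →ₗ.[ℝ] ℝ := LinearPMap.mkSpanSingleton' v₀ (q v₀) hsmul
  obtain ⟨Λ, hΛf, hΛ⟩ := exists_extension_of_le_sublinear f q hq.smul hq.add_le fun ⟨v, hv⟩ => by
    obtain ⟨c, rfl⟩ := Submodule.mem_span_singleton.1 hv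
    rw [LinearPMap.mkSpanSingleton'_apply]
    exact hq.mul_le_apply_smul c v₀
  refine ⟨Λ, ?_, hΛ⟩
  exact (hΛf ⟨v₀, Submodule.mem_span_singleton_self v₀⟩).trans
    (LinearPMap.mkSpanSingleton'_apply_self v₀ (q v₀) hsmul _)

variable {K : Module.End ℝ V}

theorem apply_pow_le (hK : ∀ v, q (K v) ≤ q v) (n : ℕ) (v : V) : q ((K ^ n) v) ≤ q v := by
  induction n with
  | zero => exact le_rfl
  | succ n ih =>
    rw [pow_succ', Module.End.mul_apply]
    exact (hK _).trans ih

theorem apply_sum_pow_le (hq : IsSublinear q) (hK : ∀ v, q (K v) ≤ q v) (n : ℕ) (v : V) :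
    q ((∑ i ∈ Finset.range n, K ^ i) v) ≤ n * q v := by
  induction n with
  | zero => simp [hq.map_zero]
  | succ n ih =>
    rw [Finset.sum_range_succ, LinearMap.add_apply, Nat.cast_succ, add_one_mul]
    exact (hq.add_le _ _).trans (add_le_add ih (apply_pow_le hK n v))

theorem subadditive_apply_sum_pow (hq : IsSublinear q) (hK : ∀ v, q (K v) ≤ q v) (v : V) :
    Subadditive fun n => q ((∑ i ∈ Finset.range n, K ^ i) v) := fun m n => by
  have hsum : ∑ i ∈ Finset.range (m + n), K ^ i =
      ∑ i ∈ Finset.range m, K ^ i + K ^ m * ∑ i ∈ Finset.range n, K ^ i := by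
    simp only [Finset.sum_range_add, Finset.mul_sum, pow_add]
  simp only [hsum, LinearMap.add_apply, Module.End.mul_apply]
  exact (hq.add_le _ _).trans (add_le_add_right (apply_pow_le hK m _) _)

theorem exists_tendsto_apply_sum_pow_div (hq : IsSublinear q) (hK : ∀ v, q (K v) ≤ q v) (v : V) :
    ∃ l ≤ q v,
      Tendsto (fun n : ℕ => q ((∑ i ∈ Finset.range n, K ^ i) v) / n) atTop (𝓝 l) := by
  have hsub := hq.subadditive_apply_sum_pow hK v
  have hbdd : BddBelow (range fun n : ℕ => q ((∑ i ∈ Finset.range n, K ^ i) v) / n) := by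
    refine ⟨min 0 (-q (-v)), forall_mem_range.2 fun n => ?_⟩
    rcases n.eq_zero_or_pos with rfl | hn
    · simp
    have hneg := hq.apply_sum_pow_le hK n (-v)
    rw [LinearMap.map_neg] at hneg
    rw [le_div_iff₀ (by exact_mod_cast hn)]
    nlinarith [hq.neg_le ((∑ i ∈ Finset.range n, K ^ i) v), min_le_right 0 (-q (-v)),
      (Nat.cast_pos (α := ℝ)).2 hn]
  refine ⟨hsub.lim, ?_, hsub.tendsto_lim hbdd⟩
  simpa using hsub.lim_le_div hbdd one_ne_zero

theorem exists_invariant_linear_le (hq : IsSublinear q) (hK : ∀ v, q (K v) ≤ q v) (v₀ : V) :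
    ∃ Λ : V →ₗ[ℝ] ℝ, (∀ v, Λ v ≤ q v) ∧ (∀ v, Λ (K v) = Λ v) ∧
      Tendsto (fun n : ℕ => q ((∑ i ∈ Finset.range n, K ^ i) v₀) / n) atTop (𝓝 (Λ v₀)) := by
  choose p hpq hp using hq.exists_tendsto_apply_sum_pow_div hK
  have hsub : IsSublinear p :=
    ⟨fun c hc v => tendsto_nhds_unique (hp (c • v)) <| by
      simpa only [LinearMap.map_smul, hq.smul c hc, mul_div_assoc] using (hp v).const_mul c,
    fun v w => le_of_tendsto_of_tendsto' (hp (v + w)) ((hp v).add (hp w)) fun n => by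
      rw [← add_div, LinearMap.map_add]
      gcongr
      exact hq.add_le _ _⟩
  have hinv : ∀ v, p (K v - v) ≤ 0 := fun v => by
    have hconst := tendsto_const_div_atTop_nhds_zero_nat (q v + q (-v))
    refine le_of_tendsto_of_tendsto' (hp (K v - v)) hconst fun n => ?_
    have htele : (∑ i ∈ Finset.range n, K ^ i) (K v - v) = (K ^ n) v - v := by
      simpa using DFunLike.congr_fun (geom_sum_mul K n) v
    rw [htele, sub_eq_add_neg]
    gcongr
    exact (hq.add_le _ _).trans (add_le_add_left (apply_pow_le hK n v) _)
  obtain ⟨Λ, hΛ₀, hΛ⟩ := hsub.exists_linear_le_of_apply_eq v₀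
  refine ⟨Λ, fun v => (hΛ v).trans (hpq v), fun v => le_antisymm ?_ ?_, hΛ₀ ▸ hp v₀⟩
  · have h := (hΛ _).trans (hinv v)
    rw [map_sub] at h
    linarith
  · have h := (hΛ _).trans (hinv (-v))
    simp only [map_sub, map_neg] at h
    linarith

end IsSublinear

end InvariantHahnBanach

namespace BundleRDS

section FiberSup

variable {Ω : Type*} [MeasurableSpace Ω] {X : Type*} [TopologicalSpace X] [MeasurableSpace X]
  {P : Measure Ω} {ϑ : Ω → Ω} (T : BundleRDS X P ϑ)

/-- The supremum of a function on the bundle over the fibre `E_ω`, as a function of `ω`; its value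
is `0` where the function is unbounded on the fibre. -/
noncomputable def fiberSup (F : T.graph → ℝ) (ω : Ω) : ℝ :=
  ⨆ x : T.fiber ω, F ⟨(ω, x), x.2⟩

/-- Continuity of a function on the bundle along almost every fibre. -/
def IsFiberContinuous (F : T.graph → ℝ) : Prop :=
  ∀ᵐ ω ∂P, Continuous fun x : T.fiber ω => F ⟨(ω, x), x.2⟩

/-- The space of bounded measurable functions on the bundle. -/
def boundedMeasurable : Submodule ℝ (T.graph → ℝ) where
  carrier := {F | Measurable F ∧ ∃ C, ∀ p, |F p| ≤ C}
  zero_mem' := ⟨measurable_const, 0, fun _ => abs_zero.le⟩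
  add_mem' := fun ⟨hF, C, hC⟩ ⟨hG, D, hD⟩ =>
    ⟨hF.add hG, C + D, fun p => (abs_add_le _ _).trans (add_le_add (hC p) (hD p))⟩
  smul_mem' := fun c F ⟨hF, C, hC⟩ => ⟨hF.const_smul c, |c| * C, fun p => by
    rw [Pi.smul_apply, smul_eq_mul, abs_mul]
    exact mul_le_mul_of_nonneg_left (hC p) (abs_nonneg c)⟩

/-- The Koopman operator `F ↦ F ∘ Θ` of the skew product. -/
def koopman : Module.End ℝ T.boundedMeasurable where
  toFun F := ⟨F.1 ∘ T.skew, F.2.1.comp T.measurable_skew, F.2.2.imp fun _ hC _ => hC _⟩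
  map_add' _ _ := rfl
  map_smul' _ _ := rfl

instance nonempty_fiber (ω : Ω) : Nonempty (T.fiber ω) := (T.fiber_nonempty ω).to_subtype

variable {T}

theorem coe_koopman_pow (n : ℕ) (F : T.boundedMeasurable) :
    ((T.koopman ^ n) F).1 = F.1 ∘ T.skew^[n] := by
  induction n generalizing F with
  | zero => rfl
  | succ n ih =>
    rw [pow_succ, Module.End.mul_apply, ih, Function.iterate_succ']
    rfl

theorem coe_sum_koopman_pow (n : ℕ) (F : T.boundedMeasurable) :
    ((∑ i ∈ Finset.range n, T.koopman ^ i) F).1 = birkhoffSum T.skew F.1 n := by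
  ext p
  simp [birkhoffSum, LinearMap.sum_apply, coe_koopman_pow]

theorem le_fiberSup (F : T.boundedMeasurable) (p : T.graph) : F.1 p ≤ T.fiberSup F.1 p.1.1 := by
  obtain ⟨C, hC⟩ := F.2.2
  have hbdd : BddAbove (range fun x : T.fiber p.1.1 => F.1 ⟨(p.1.1, x), x.2⟩) :=
    ⟨C, forall_mem_range.2 fun _ => (abs_le.1 (hC _)).2⟩
  exact le_ciSup hbdd ⟨p.1.2, p.2⟩

theorem fiberSup_le {F : T.graph → ℝ} {ω : Ω} {c : ℝ}
    (h : ∀ x (hx : (ω, x) ∈ T.graph), F ⟨(ω, x), hx⟩ ≤ c) : T.fiberSup F ω ≤ c :=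
  ciSup_le fun x => h x x.2

theorem fiberSup_le_iff (F : T.boundedMeasurable) {ω : Ω} {c : ℝ} :
    T.fiberSup F.1 ω ≤ c ↔ ∀ x (hx : (ω, x) ∈ T.graph), F.1 ⟨(ω, x), hx⟩ ≤ c :=
  ⟨fun h _ _ => (le_fiberSup F _).trans h, fiberSup_le⟩

theorem abs_fiberSup_le {F : T.boundedMeasurable} {C : ℝ} {ω : Ω}
    (hC : ∀ x (hx : (ω, x) ∈ T.graph), |F.1 ⟨(ω, x), hx⟩| ≤ C) : |T.fiberSup F.1 ω| ≤ C := by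
  obtain ⟨x, hx⟩ := T.fiber_nonempty ω
  exact abs_le.2 ⟨(abs_le.1 (hC x hx)).1.trans (le_fiberSup F ⟨(ω, x), hx⟩),
    fiberSup_le fun x hx => (abs_le.1 (hC x hx)).2⟩

theorem fiberSup_add_le (F G : T.boundedMeasurable) (ω : Ω) :
    T.fiberSup (F + G).1 ω ≤ T.fiberSup F.1 ω + T.fiberSup G.1 ω :=
  fiberSup_le fun _ _ => add_le_add (le_fiberSup F _) (le_fiberSup G _)

theorem fiberSup_smul {c : ℝ} (hc : 0 ≤ c) (F : T.graph → ℝ) (ω : Ω) :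
    T.fiberSup (c • F) ω = c * T.fiberSup F ω :=
  (Real.mul_iSup_of_nonneg hc _).symm

theorem fiberSup_koopman_le (F : T.boundedMeasurable) (ω : Ω) :
    T.fiberSup (T.koopman F).1 ω ≤ T.fiberSup F.1 (ϑ ω) :=
  fiberSup_le fun _ _ => le_fiberSup F _

end FiberSup

section SupIntegral

variable {Ω : Type*} [MeasurableSpace Ω] {X : Type*} [TopologicalSpace X] [MeasurableSpace X]
  {P : Measure Ω} {ϑ : Ω → Ω}

/-- The integral over `P` of the supremum over the fibres: the sublinear functional whose averages
along `koopman` are compared with invariant measures. -/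
noncomputable def supIntegral (T : BundleRDS X P ϑ) (F : T.boundedMeasurable) : ℝ :=
  ∫ ω, T.fiberSup F.1 ω ∂P

variable {T : BundleRDS X P ϑ} [PolishSpace X] [BorelSpace X] [IsFiniteMeasure P]

theorem nullMeasurableSet_forall_mem_fiber {S : Set T.graph} (hS : MeasurableSet S) :
    NullMeasurableSet {ω | ∀ x (hx : (ω, x) ∈ T.graph), ⟨(ω, x), hx⟩ ∈ S} P := by
  have himage : {ω | ∀ x (hx : (ω, x) ∈ T.graph), ⟨(ω, x), hx⟩ ∈ S} =
      (Prod.fst '' ((Subtype.val : T.graph → Ω × X) '' Sᶜ))ᶜ := by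
    ext ω
    simp only [mem_ofPred_eq, mem_compl_iff, mem_image, not_exists, not_and]
    constructor
    · rintro h _ ⟨p, hp, rfl⟩ rfl
      exact hp (h _ p.2)
    · intro h x hx
      by_contra hS
      exact h _ ⟨_, hS, rfl⟩ rfl
  rw [himage]
  exact (nullMeasurableSet_image_fst P (T.measurableSet_graph.subtype_image hS.compl)).compl

theorem aemeasurable_fiberSup (F : T.boundedMeasurable) : AEMeasurable (T.fiberSup F.1) P := by
  have hIic : ∀ a, NullMeasurableSet (T.fiberSup F.1 ⁻¹' Iic a) P := fun a => by
    simpa only [preimage, mem_Iic, fiberSup_le_iff F, mem_ofPred_eq] using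
      nullMeasurableSet_forall_mem_fiber (measurableSet_le F.2.1 (measurable_const (a := a)))
  exact NullMeasurable.aemeasurable fun _ hs =>
    measurable_of_Iic (δ := NullMeasurableSpace Ω P) hIic hs

theorem integrable_fiberSup (F : T.boundedMeasurable) : Integrable (T.fiberSup F.1) P := by
  obtain ⟨C, hC⟩ := F.2.2
  exact .of_bound (aemeasurable_fiberSup F).aestronglyMeasurable C
    (Eventually.of_forall fun _ => abs_fiberSup_le fun _ _ => hC _)

theorem isSublinear_supIntegral : IsSublinear T.supIntegral where
  smul c hc F := by
    simp only [supIntegral, Submodule.coe_smul, fiberSup_smul hc.le, integral_const_mul]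
  add_le F G := by
    rw [supIntegral, supIntegral, supIntegral,
      ← integral_add (integrable_fiberSup F) (integrable_fiberSup G)]
    exact integral_mono (integrable_fiberSup _)
      ((integrable_fiberSup F).add (integrable_fiberSup G)) (fiberSup_add_le F G)

theorem supIntegral_koopman_le (F : T.boundedMeasurable) :
    T.supIntegral (T.koopman F) ≤ T.supIntegral F := by
  have hint := integrable_fiberSup F
  calc T.supIntegral (T.koopman F) ≤ ∫ ω, T.fiberSup F.1 (ϑ ω) ∂P :=
        integral_mono (integrable_fiberSup _)
          (T.base_measurePreserving.integrable_comp_of_integrable hint) (fiberSup_koopman_le F)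
    _ = T.supIntegral F :=
        integral_comp_of_measurePreserving T.base_measurePreserving hint.aestronglyMeasurable

theorem supIntegral_le_of_ae_le {F : T.boundedMeasurable} {h : Ω → ℝ} (hh : Integrable h P)
    (hF : ∀ᵐ ω ∂P, ∀ x (hx : (ω, x) ∈ T.graph), F.1 ⟨(ω, x), hx⟩ ≤ h ω) :
    T.supIntegral F ≤ ∫ ω, h ω ∂P :=
  integral_mono_ae (integrable_fiberSup F) hh (hF.mono fun _ => fiberSup_le)

end SupIntegral

end BundleRDS

theorem exists_measurable_forall_ae_of_ae_exists {Ω : Type*} [MeasurableSpace Ω] {P : Measure Ω}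
    {p : Ω → ℕ → Prop} (hp : ∀ j, NullMeasurableSet {ω | p ω j} P) (h : ∀ᵐ ω ∂P, ∃ j, p ω j) :
    ∃ φ : Ω → ℕ, Measurable φ ∧ ∀ᵐ ω ∂P, p ω (φ ω) := by
  classical
  choose A hAp hA hAe using fun j => (hp j).exists_measurable_subset_ae_eq
  have hex : ∀ ω, ∃ j, ω ∈ A j ∪ (⋃ i, A i)ᶜ := fun ω => by
    by_cases hω : ω ∈ ⋃ i, A i
    · exact (mem_iUnion.1 hω).imp fun _ => Or.inl
    · exact ⟨0, Or.inr hω⟩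
  refine ⟨fun ω => Nat.find (hex ω),
    measurable_find hex fun j => (hA j).union (MeasurableSet.iUnion hA).compl, ?_⟩
  filter_upwards [h, ae_all_iff.2 fun j => (hAe j).mem_iff] with ω ⟨j, hj⟩ hω
  exact hAp _ ((Nat.find_spec (hex ω)).resolve_right fun hc =>
    hc (mem_iUnion.2 ⟨j, (hω j).2 hj⟩))

theorem exists_abs_sub_denseSeq_le {X : Type*} [MetricSpace X] [CompactSpace X] {K : Set X}
    (hK : IsClosed K) {f : K → ℝ} (hf : Continuous f) {C ε : ℝ} (hC : ∀ x, |f x| ≤ C)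
    (hC0 : 0 ≤ C) (hε : 0 < ε) :
    ∃ j, ‖TopologicalSpace.denseSeq C(X, ℝ) j‖ ≤ C + ε ∧
      ∀ x : K, |f x - TopologicalSpace.denseSeq C(X, ℝ) j x| ≤ ε := by
  obtain ⟨g, hgC, hgf⟩ := ContinuousMap.exists_restrict_eq_forall_mem_of_closed ⟨f, hf⟩
    (t := Icc (-C) C) (fun x => abs_le.1 (hC x)) (nonempty_Icc.2 (neg_le_self hC0)) hK
  have hgnorm : ‖g‖ ≤ C := (ContinuousMap.norm_le g hC0).2 fun x => abs_le.2 (hgC x)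
  obtain ⟨j, hj⟩ := (TopologicalSpace.denseRange_denseSeq C(X, ℝ)).exists_dist_lt g hε
  refine ⟨j, ?_, fun x => ?_⟩
  · exact (norm_le_norm_add_norm_sub' _ g).trans
      (add_le_add hgnorm ((norm_sub_rev _ g).trans_le (dist_eq_norm g _ ▸ hj.le)))
  · have hgx : g x = f x := DFunLike.congr_fun hgf x
    rw [← hgx]
    exact (ContinuousMap.dist_apply_le_dist (x : X)).trans hj.le

namespace BundleRDS

section Representation

variable {Ω : Type*} [MeasurableSpace Ω] {X : Type*} [MetricSpace X] [CompactSpace X]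
  [MeasurableSpace X] [BorelSpace X] {P : Measure Ω} {ϑ : Ω → Ω}

/-- The function `(ω, x) ↦ s ω x` on the bundle, for a simple function `s` with values in
`C(X, ℝ)`. -/
def ofSimpleFunc (T : BundleRDS X P ϑ) : SimpleFunc Ω C(X, ℝ) →ₗ[ℝ] T.boundedMeasurable where
  toFun s := ⟨fun p => s p.1.1 p.1.2,
    (measurable_simpleFunc_apply s).comp measurable_subtype_coe,
    s.exists_forall_norm_le.imp fun _ hC p => ((s p.1.1).norm_coe_le_norm p.1.2).trans (hC p.1.1)⟩
  map_add' _ _ := rfl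
  map_smul' _ _ := rfl

variable {T : BundleRDS X P ϑ} {Λ : T.boundedMeasurable →ₗ[ℝ] ℝ}

theorem coe_ofSimpleFunc (s : SimpleFunc Ω C(X, ℝ)) (p : T.graph) :
    (T.ofSimpleFunc s).1 p = s p.1.1 p.1.2 := rfl

variable [IsFiniteMeasure P]

theorem apply_le_integral_of_ae_le (hΛ : ∀ F, Λ F ≤ T.supIntegral F) {F : T.boundedMeasurable}
    {h : Ω → ℝ} (hh : Integrable h P)
    (hF : ∀ᵐ ω ∂P, ∀ x (hx : (ω, x) ∈ T.graph), F.1 ⟨(ω, x), hx⟩ ≤ h ω) : Λ F ≤ ∫ ω, h ω ∂P :=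
  (hΛ F).trans (supIntegral_le_of_ae_le hh hF)

theorem integral_le_apply_of_ae_le (hΛ : ∀ F, Λ F ≤ T.supIntegral F) {F : T.boundedMeasurable}
    {h : Ω → ℝ} (hh : Integrable h P)
    (hF : ∀ᵐ ω ∂P, ∀ x (hx : (ω, x) ∈ T.graph), h ω ≤ F.1 ⟨(ω, x), hx⟩) :
    ∫ ω, h ω ∂P ≤ Λ F := by
  have hneg := apply_le_integral_of_ae_le hΛ (F := -F) hh.neg
    (hF.mono fun _ hω x hx => neg_le_neg (hω x hx))
  simp only [map_neg, Pi.neg_apply, integral_neg] at hneg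
  exact neg_le_neg_iff.1 hneg

theorem isPositiveOver_comp_ofSimpleFunc (hΛ : ∀ F, Λ F ≤ T.supIntegral F) :
    IsPositiveOver P (Λ ∘ₗ T.ofSimpleFunc) where
  nonneg s hs := by
    simpa using integral_le_apply_of_ae_le hΛ (F := T.ofSimpleFunc s) (integrable_zero Ω ℝ P)
      (Eventually.of_forall fun ω x _ => hs ω x)
  apply_one A hA := by
    have hint : Integrable (A.indicator 1) P := (integrable_const (1 : ℝ)).indicator hA
    have hone : ∀ ω x (hx : (ω, x) ∈ T.graph),
        (T.ofSimpleFunc (restrictConst A 1)).1 ⟨(ω, x), hx⟩ = A.indicator 1 ω := fun ω x hx => by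
      by_cases hω : ω ∈ A <;> simp [coe_ofSimpleFunc, restrictConst_apply hA, hω]
    rw [LinearMap.comp_apply, ← integral_indicator_one hA]
    exact le_antisymm
      (apply_le_integral_of_ae_le hΛ hint (Eventually.of_forall fun ω x hx => (hone ω x hx).le))
      (integral_le_apply_of_ae_le hΛ hint (Eventually.of_forall fun ω x hx => (hone ω x hx).ge))

theorem ae_apply_snd_nonpos_of_forall_fiber_nonpos {m : Measure (Ω × X)} [IsFiniteMeasure m]
    (hfst : m.map Prod.fst = P)
    (hm : ∀ s, T.ofSimpleFunc s = 0 → ∫ p, s p.1 p.2 ∂m = 0) (f : C(X, ℝ)) :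
    ∀ᵐ p ∂m, (∀ x, (p.1, x) ∈ T.graph → f x ≤ 0) → f p.2 ≤ 0 := by
  have hnull : NullMeasurableSet {ω | ∀ x, (ω, x) ∈ T.graph → f x ≤ 0} P :=
    nullMeasurableSet_forall_mem_fiber (T := T)
      (measurableSet_le (T.ofSimpleFunc (SimpleFunc.const Ω f)).2.1 measurable_const)
  obtain ⟨A, hAf, hA, hAe⟩ := hnull.exists_measurable_subset_ae_eq
  have hfstA : ∀ᵐ p ∂m, (∀ x, (p.1, x) ∈ T.graph → f x ≤ 0) → p.1 ∈ A := by
    have hP : ∀ᵐ ω ∂m.map Prod.fst, (∀ x, (ω, x) ∈ T.graph → f x ≤ 0) → ω ∈ A :=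
      hfst ▸ hAe.mem_iff.mono fun _ hω => hω.2
    exact ae_of_ae_map measurable_fst.aemeasurable hP
  let s : SimpleFunc Ω C(X, ℝ) := restrictConst A (f ⊔ 0)
  have hs : ∀ ω, 0 ≤ s ω := restrictConst_nonneg A le_sup_right
  have hs0 : T.ofSimpleFunc s = 0 := by
    ext p
    by_cases hp : p.1.1 ∈ A
    · simpa [s, coe_ofSimpleFunc, restrictConst_apply hA, hp] using hAf hp p.1.2 p.2
    · simp [s, coe_ofSimpleFunc, restrictConst_apply hA, hp]
  have hae := (integral_eq_zero_iff_of_nonneg (fun p : Ω × X => hs p.1 p.2)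
    (integrable_simpleFunc_apply m s)).1 (hm s hs0)
  filter_upwards [hfstA, hae] with p hpA hp hf
  simpa [s, restrictConst_apply hA, hpA hf] using hp

theorem ae_mem_graph_of_forall_integral_eq_zero {m : Measure (Ω × X)} [IsFiniteMeasure m]
    (hfst : m.map Prod.fst = P)
    (hm : ∀ s, T.ofSimpleFunc s = 0 → ∫ p, s p.1 p.2 ∂m = 0) : ∀ᵐ p ∂m, p ∈ T.graph := by
  let g := TopologicalSpace.denseSeq C(X, ℝ)
  filter_upwards [ae_all_iff.2 fun j => ae_apply_snd_nonpos_of_forall_fiber_nonpos hfst hm (g j)]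
    with p hp
  by_contra hpT
  obtain ⟨f, hf0, hf1, -⟩ := exists_continuous_zero_one_of_isClosed (T.fiber_isCompact p.1).isClosed
    isClosed_singleton (disjoint_singleton_right.2 hpT)
  obtain ⟨j, hj⟩ := (TopologicalSpace.denseRange_denseSeq C(X, ℝ)).exists_dist_lt
    (f - ContinuousMap.const X 2⁻¹) (ε := 2⁻¹) (by norm_num)
  have hdist : ∀ x, |f x - 2⁻¹ - g j x| < 2⁻¹ := fun x =>
    (ContinuousMap.dist_apply_le_dist x).trans_lt hj
  have hfp : f p.2 = 1 := hf1 rfl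
  refine (hp j fun x hx => ?_).not_gt ?_
  · have hfx : f x = 0 := hf0 hx
    linarith [(abs_lt.1 (hdist x)).1]
  · linarith [(abs_lt.1 (hdist p.2)).2]

end Representation

section Density

variable {Ω : Type*} [MeasurableSpace Ω] {X : Type*} [MetricSpace X] [CompactSpace X]
  [MeasurableSpace X] [BorelSpace X] {P : Measure Ω} {ϑ : Ω → Ω} {T : BundleRDS X P ϑ}

theorem isFiberContinuous_ofSimpleFunc (s : SimpleFunc Ω C(X, ℝ)) :
    T.IsFiberContinuous (T.ofSimpleFunc s).1 :=
  Eventually.of_forall fun ω => (s ω).continuous.comp continuous_subtype_val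

theorem isFiberContinuous_koopman_ofSimpleFunc (s : SimpleFunc Ω C(X, ℝ)) :
    T.IsFiberContinuous (T.koopman (T.ofSimpleFunc s)).1 := by
  filter_upwards [T.continuous_map] with ω hω
  exact (s (ϑ ω)).continuous.comp (continuous_subtype_val.comp hω)

variable [IsFiniteMeasure P]

theorem exists_stronglyMeasurable_abs_sub_le {F : T.boundedMeasurable}
    (hF : T.IsFiberContinuous F.1) {C : ℝ} (hC : ∀ p, |F.1 p| ≤ C) {ε : ℝ} (hε : 0 < ε) :
    ∃ γ : Ω → C(X, ℝ), StronglyMeasurable γ ∧ ∀ᵐ ω ∂P, ‖γ ω‖ ≤ C + ε ∧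
      ∀ x (hx : (ω, x) ∈ T.graph), |F.1 ⟨(ω, x), hx⟩ - γ ω x| ≤ ε := by
  let g := TopologicalSpace.denseSeq C(X, ℝ)
  let S : ℕ → Set T.graph := fun j => {p | ‖g j‖ ≤ C + ε ∧ |F.1 p - g j p.1.2| ≤ ε}
  have hS : ∀ j, MeasurableSet (S j) := fun j => (MeasurableSet.const _).inter <|
    measurableSet_le ((F.2.1.sub ((g j).continuous.measurable.comp
      (measurable_snd.comp measurable_subtype_coe))).abs) measurable_const
  obtain ⟨φ, hφ, hφS⟩ := exists_measurable_forall_ae_of_ae_exists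
    (fun j => nullMeasurableSet_forall_mem_fiber (hS j)) <| hF.mono fun ω hω => by
      obtain ⟨x, hx⟩ := T.fiber_nonempty ω
      obtain ⟨j, hgj, hj⟩ := exists_abs_sub_denseSeq_le (T.fiber_isCompact ω).isClosed hω
        (fun x => hC _) ((abs_nonneg _).trans (hC ⟨(ω, x), hx⟩)) hε
      exact ⟨j, fun x hx => ⟨hgj, hj ⟨x, hx⟩⟩⟩
  refine ⟨g ∘ φ, StronglyMeasurable.of_discrete.comp_measurable hφ, hφS.mono fun ω hω => ?_⟩
  obtain ⟨x, hx⟩ := T.fiber_nonempty ω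
  exact ⟨(hω x hx).1, fun x hx => (hω x hx).2⟩

theorem exists_ofSimpleFunc_abs_sub_le {F : T.boundedMeasurable} (hF : T.IsFiberContinuous F.1)
    {ε : ℝ} (hε : 0 < ε) :
    ∃ (s : SimpleFunc Ω C(X, ℝ)) (h : Ω → ℝ), Integrable h P ∧ ∫ ω, h ω ∂P ≤ ε ∧
      ∀ᵐ ω ∂P, ∀ x (hx : (ω, x) ∈ T.graph), |(F - T.ofSimpleFunc s).1 ⟨(ω, x), hx⟩| ≤ h ω := by
  obtain ⟨C, hC⟩ := F.2.2
  let δ : ℝ := ε / (P.real univ + 1)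
  have hδ : 0 < δ := by positivity
  obtain ⟨γ, hγ, hγF⟩ := exists_stronglyMeasurable_abs_sub_le hF hC hδ
  have hγint : Integrable γ P :=
    .of_bound hγ.aestronglyMeasurable (C + δ) (hγF.mono fun _ hω => hω.1)
  obtain ⟨s, hs, hsint⟩ := (memLp_one_iff_integrable.2 hγint).exists_simpleFunc_eLpNorm_sub_lt
    ENNReal.one_ne_top (ENNReal.ofReal_pos.2 hδ).ne'
  have hdiff : Integrable (fun ω => γ ω - s ω) P := hγint.sub (memLp_one_iff_integrable.1 hsint)
  refine ⟨s, fun ω => δ + ‖γ ω - s ω‖, (integrable_const δ).add hdiff.norm, ?_, ?_⟩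
  · rw [integral_add (integrable_const δ) hdiff.norm, integral_const, smul_eq_mul]
    have hnorm : ∫ ω, ‖γ ω - s ω‖ ∂P ≤ δ := by
      rw [integral_norm_eq_lintegral_enorm hdiff.1, ← eLpNorm_one_eq_lintegral_enorm]
      exact ENNReal.toReal_le_of_le_ofReal hδ.le hs.le
    calc P.real univ * δ + ∫ ω, ‖γ ω - s ω‖ ∂P ≤ P.real univ * δ + δ := by gcongr
      _ = ε := by simp only [δ]; field_simp
  · filter_upwards [hγF] with ω hω x hx
    exact (abs_sub_le _ (γ ω x) _).trans
      (add_le_add (hω.2 x hx) ((γ ω - s ω).norm_coe_le_norm x))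

variable {Λ Λ' : T.boundedMeasurable →ₗ[ℝ] ℝ}

theorem eq_of_forall_ofSimpleFunc_eq (hΛ : ∀ F, Λ F ≤ T.supIntegral F)
    (hΛ' : ∀ F, Λ' F ≤ T.supIntegral F)
    (h : ∀ s, Λ (T.ofSimpleFunc s) = Λ' (T.ofSimpleFunc s)) {F : T.boundedMeasurable}
    (hF : T.IsFiberContinuous F.1) : Λ F = Λ' F := by
  suffices hle : ∀ {Λ Λ' : T.boundedMeasurable →ₗ[ℝ] ℝ}, (∀ F, Λ F ≤ T.supIntegral F) →
      (∀ F, Λ' F ≤ T.supIntegral F) →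
      (∀ s, Λ (T.ofSimpleFunc s) = Λ' (T.ofSimpleFunc s)) → Λ F ≤ Λ' F from
    le_antisymm (hle hΛ hΛ' h) (hle hΛ' hΛ fun s => (h s).symm)
  intro Λ Λ' hΛ hΛ' h
  refine le_of_forall_pos_le_add fun ε hε => ?_
  obtain ⟨s, k, hk, hkε, hs⟩ := exists_ofSimpleFunc_abs_sub_le hF (half_pos hε)
  have hupper := apply_le_integral_of_ae_le hΛ hk
    (hs.mono fun ω hω x hx => (abs_le.1 (hω x hx)).2)
  have hlower := integral_le_apply_of_ae_le hΛ' hk.neg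
    (hs.mono fun ω hω x hx => (abs_le.1 (hω x hx)).1)
  simp only [map_sub, Pi.neg_apply, integral_neg] at hupper hlower
  linarith [h s]

end Density


section InvariantMeasure

variable {Ω : Type*} [MeasurableSpace Ω] {X : Type*} [TopologicalSpace X] [MeasurableSpace X]
  {P : Measure Ω} {ϑ : Ω → Ω} {T : BundleRDS X P ϑ}

theorem integrable_boundedMeasurable (n : Measure T.graph) [IsFiniteMeasure n]
    (F : T.boundedMeasurable) : Integrable F.1 n := by
  obtain ⟨C, hC⟩ := F.2.2
  exact .of_bound F.2.1.aestronglyMeasurable C (Eventually.of_forall hC)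

/-- Integration against a finite measure on the bundle. -/
noncomputable def integralLinearMap (n : Measure T.graph) [IsFiniteMeasure n] :
    T.boundedMeasurable →ₗ[ℝ] ℝ where
  toFun F := ∫ p, F.1 p ∂n
  map_add' F G :=
    integral_add (integrable_boundedMeasurable n F) (integrable_boundedMeasurable n G)
  map_smul' c F := integral_const_mul c F.1

theorem integralLinearMap_le_supIntegral [PolishSpace X] [BorelSpace X] [IsFiniteMeasure P]
    {n : Measure T.graph} [IsFiniteMeasure n]
    (hn : MeasurePreserving (fun p : T.graph => p.1.1) n P) (F : T.boundedMeasurable) :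
    integralLinearMap n F ≤ T.supIntegral F := by
  have hint := integrable_fiberSup F
  calc ∫ p, F.1 p ∂n ≤ ∫ p, T.fiberSup F.1 p.1.1 ∂n :=
        integral_mono (integrable_boundedMeasurable n F) (hn.integrable_comp_of_integrable hint)
          (le_fiberSup F)
    _ = T.supIntegral F := integral_comp_of_measurePreserving hn hint.aestronglyMeasurable

theorem map_comap_graph {m : Measure (Ω × X)} (hT : ∀ᵐ p ∂m, p ∈ T.graph) :
    (m.comap ((↑) : T.graph → Ω × X)).map (↑) = m := by
  rw [map_comap_subtype_coe T.measurableSet_graph, Measure.restrict_eq_self_of_ae_mem hT]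

theorem measurePreserving_comap_graph {m : Measure (Ω × X)} (hfst : m.map Prod.fst = P)
    (hT : ∀ᵐ p ∂m, p ∈ T.graph) :
    MeasurePreserving (fun p : T.graph => p.1.1) (m.comap (↑)) P :=
  (MeasurePreserving.mk measurable_fst hfst).comp ⟨measurable_subtype_coe, map_comap_graph hT⟩

theorem mem_invariantMeasures_of_measurePreserving [IsProbabilityMeasure P] {m : Measure (Ω × X)}
    (hfst : m.map Prod.fst = P) (hT : ∀ᵐ p ∂m, p ∈ T.graph)
    (hskew : MeasurePreserving T.skew (m.comap Subtype.val) (m.comap Subtype.val)) :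
    m ∈ T.invariantMeasures := by
  have hm : IsProbabilityMeasure m := by
    rw [← Measure.isProbabilityMeasure_map_iff measurable_fst.aemeasurable, hfst]
    infer_instance
  exact ⟨hm, hfst, (mem_ae_iff_prob_eq_one T.measurableSet_graph).1 hT, hskew⟩

end InvariantMeasure

section Existence

variable {Ω : Type*} [MeasurableSpace Ω] {X : Type*} [MetricSpace X] [CompactSpace X]
  [MeasurableSpace X] [BorelSpace X] {P : Measure Ω} {ϑ : Ω → Ω} {T : BundleRDS X P ϑ}

theorem measurePreserving_skew_of_forall_integral_eq {n : Measure T.graph} [IsFiniteMeasure n]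
    (h : ∀ s, integralLinearMap n (T.koopman (T.ofSimpleFunc s)) =
      integralLinearMap n (T.ofSimpleFunc s)) : MeasurePreserving T.skew n n := by
  refine ⟨T.measurable_skew, ?_⟩
  have hval := MeasurableEmbedding.subtype_coe T.measurableSet_graph
  have hmap : (n.map T.skew).map Subtype.val = n.map Subtype.val :=
    ext_of_forall_integral_simpleFunc_eq fun s => by
      rw [hval.integral_map, hval.integral_map]
      exact (integral_map T.measurable_skew.aemeasurable
        (T.ofSimpleFunc s).2.1.aestronglyMeasurable).trans (h s)
  rw [← hval.comap_map (n.map T.skew), hmap, hval.comap_map]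

theorem exists_mem_invariantMeasures_tendsto [IsProbabilityMeasure P] {F₀ : T.boundedMeasurable}
    (hF₀ : T.IsFiberContinuous F₀.1) :
    ∃ m ∈ T.invariantMeasures,
      Tendsto (fun n : ℕ => T.supIntegral ((∑ i ∈ Finset.range n, T.koopman ^ i) F₀) / n) atTop
        (𝓝 (∫ p : T.graph, F₀.1 p ∂m.comap Subtype.val)) := by
  obtain ⟨Λ, hΛ, hinv, hlim⟩ :=
    isSublinear_supIntegral.exists_invariant_linear_le supIntegral_koopman_le F₀
  obtain ⟨m, hfst, hm⟩ := (isPositiveOver_comp_ofSimpleFunc hΛ).exists_measure_integral_eq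
  have hfin : IsFiniteMeasure m := by
    rw [← Measure.isFiniteMeasure_map_iff measurable_fst.aemeasurable, hfst]
    infer_instance
  have hT : ∀ᵐ p ∂m, p ∈ T.graph := ae_mem_graph_of_forall_integral_eq_zero hfst fun s hs => by
    rw [hm, LinearMap.comp_apply, hs, map_zero]
  have hnP := measurePreserving_comap_graph hfst hT
  have heq : ∀ {F : T.boundedMeasurable}, T.IsFiberContinuous F.1 →
      Λ F = integralLinearMap (m.comap (↑)) F :=
    eq_of_forall_ofSimpleFunc_eq hΛ (integralLinearMap_le_supIntegral hnP) fun s => by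
      rw [← LinearMap.comp_apply, ← hm]
      conv_lhs => rw [← map_comap_graph hT]
      rw [(MeasurableEmbedding.subtype_coe T.measurableSet_graph).integral_map]
      rfl
  rw [heq hF₀] at hlim
  refine ⟨m, mem_invariantMeasures_of_measurePreserving hfst hT ?_, hlim⟩
  refine measurePreserving_skew_of_forall_integral_eq fun s => ?_
  rw [← heq (isFiberContinuous_koopman_ofSimpleFunc s), hinv,
    heq (isFiberContinuous_ofSimpleFunc s)]

end Existence

end BundleRDS

section BirkhoffSum

theorem sum_range_le_sum_range_add {a : ℕ → ℝ} (ha : ∀ k, a k ∈ Icc 0 1) (n j : ℕ) :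
    ∑ i ∈ Finset.range n, a i ≤ ∑ i ∈ Finset.range n, a (j + i) + j := by
  have hmono : ∑ i ∈ Finset.range n, a i ≤ ∑ i ∈ Finset.range (j + n), a i :=
    Finset.sum_le_sum_of_subset_of_nonneg (Finset.range_mono (Nat.le_add_left n j))
      fun i _ _ => (ha i).1
  have hj : ∑ i ∈ Finset.range j, a i ≤ j := by
    simpa using Finset.sum_le_card_nsmul (Finset.range j) a 1 fun i _ => (ha i).2
  rw [Finset.sum_range_add] at hmono
  linarith

theorem mul_birkhoffSum_le {α : Type*} (θ : α → α) {F : α → ℝ} (hF : ∀ p, F p ∈ Icc 0 1)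
    (m n : ℕ) (p : α) :
    m * birkhoffSum θ F n p ≤ birkhoffSum θ (birkhoffSum θ F m) n p + m ^ 2 := by
  have hswap : birkhoffSum θ (birkhoffSum θ F m) n p =
      ∑ j ∈ Finset.range m, ∑ i ∈ Finset.range n, F (θ^[j + i] p) := by
    simp only [birkhoffSum, ← Function.iterate_add_apply]
    exact Finset.sum_comm
  have hshift : ∀ j ∈ Finset.range m, birkhoffSum θ F n p - m ≤
      ∑ i ∈ Finset.range n, F (θ^[j + i] p) := fun j hj => by
    have hjm : (j : ℝ) ≤ m := by exact_mod_cast (Finset.mem_range.1 hj).le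
    have hsum := sum_range_le_sum_range_add (a := fun k => F (θ^[k] p)) (fun k => hF _) n j
    rw [birkhoffSum]
    linarith
  have hm := Finset.card_nsmul_le_sum _ _ _ hshift
  rw [Finset.card_range, nsmul_eq_mul, ← hswap] at hm
  linarith

end BirkhoffSum

theorem tendsto_one_div_mul_of_forall_le_add_mul {a : ℕ → ℝ} (ha : ∀ n, 0 ≤ a n)
    (h : ∀ ε > 0, ∃ M, ∀ n : ℕ, a n ≤ M + n * ε) :
    Tendsto (fun n : ℕ => 1 / (n : ℝ) * a n) atTop (𝓝 0) := by
  refine tendsto_order.2 ⟨fun b hb => Eventually.of_forall fun n =>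
    hb.trans_le (mul_nonneg (by positivity) (ha n)), fun b hb => ?_⟩
  obtain ⟨M, hM⟩ := h (b / 2) (half_pos hb)
  filter_upwards [eventually_gt_atTop 0,
    tendsto_natCast_atTop_atTop.eventually_gt_atTop (M / (b / 2))] with n hn hMn
  rw [div_lt_iff₀ (half_pos hb)] at hMn
  rw [one_div, inv_mul_lt_iff₀ (Nat.cast_pos.2 hn)]
  linarith [hM n]

theorem exists_continuous_integral_lt_of_measureReal_lt {X : Type*} [PseudoEMetricSpace X]
    [MeasurableSpace X] [OpensMeasurableSpace X] {ν : Measure X} [IsFiniteMeasure ν] {E : Set X}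
    (hE : IsClosed E) {c : ℝ} (hc : ν.real E < c) :
    ∃ f : C(X, ℝ), (∀ x, f x ∈ Icc 0 1) ∧ (∀ x ∈ E, f x = 1) ∧ ∫ x, f x ∂ν < c := by
  have hlim := tendsto_integral_thickenedIndicator_of_isClosed ν hE
    (fun _ => Nat.one_div_pos_of_nat) tendsto_one_div_add_atTop_nhds_zero_nat
  obtain ⟨n, hn⟩ := (hlim.eventually_lt_const hc).exists
  let g := thickenedIndicator (Nat.one_div_pos_of_nat (α := ℝ) (n := n)) E
  refine ⟨⟨fun x => (g x : ℝ), NNReal.continuous_coe.comp g.continuous⟩, fun x => ⟨(g x).2, ?_⟩,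
    fun x hx => ?_, hn⟩
  · exact NNReal.coe_le_one.2 (thickenedIndicator_le_one _ E x)
  · exact NNReal.coe_eq_one.2 (thickenedIndicator_one _ E hx)

theorem countable_setOf_measure_prod_sphere_ne_zero {Ω X : Type*} [MeasurableSpace Ω]
    [PseudoMetricSpace X] [MeasurableSpace X] [OpensMeasurableSpace X] (μ : Measure (Ω × X))
    [SFinite μ] (x : X) :
    {r : ℝ | μ (univ ×ˢ Metric.sphere x r) ≠ 0}.Countable := by
  have h := Measure.countable_meas_pos_of_disjoint_iUnion (μ := μ)
    (As := fun r : ℝ => (univ : Set Ω) ×ˢ Metric.sphere x r)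
    (fun r => MeasurableSet.univ.prod Metric.isClosed_sphere.measurableSet)
    fun r s hrs => disjoint_left.2 fun p hp hq => hrs (hp.2.symm.trans hq.2)
  exact h.mono fun r hr => pos_iff_ne_zero.2 hr

namespace BundleRDS

section Visits

variable {Ω : Type*} [MeasurableSpace Ω] {X : Type*} [TopologicalSpace X] [MeasurableSpace X]
  {P : Measure Ω} {ϑ : Ω → Ω} {T : BundleRDS X P ϑ}

theorem integral_comap_graph_comp_snd {μ : Measure (Ω × X)} (hμ : μ ∈ T.invariantMeasures)
    {f : X → ℝ} (hf : AEStronglyMeasurable f (μ.map Prod.snd)) :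
    ∫ p : T.graph, f p.1.2 ∂μ.comap (↑) = ∫ x, f x ∂μ.map Prod.snd := by
  have := hμ.1
  have hae : ∀ᵐ p ∂μ, p ∈ T.graph := (mem_ae_iff_prob_eq_one T.measurableSet_graph).2 hμ.2.2.1
  rw [integral_map measurable_snd.aemeasurable hf]
  conv_rhs => rw [← map_comap_graph hae]
  rw [(MeasurableEmbedding.subtype_coe T.measurableSet_graph).integral_map]

theorem maxVisits_nonneg (E : Set X) (n : ℕ) (ω : Ω) : 0 ≤ T.maxVisits E n ω :=
  Real.iSup_nonneg fun _ => Finset.sum_nonneg fun _ _ =>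
    indicator_nonneg (fun _ _ => zero_le_one) _

theorem maxVisits_mono {E E' : Set X} (h : E ⊆ E') (n : ℕ) (ω : Ω) :
    T.maxVisits E n ω ≤ T.maxVisits E' n ω := by
  have hbdd : BddAbove (range fun x : T.fiber ω =>
      ∑ i ∈ Finset.range n, E'.indicator (fun _ => (1 : ℝ)) (T.iter i ω x : X)) :=
    ⟨n, forall_mem_range.2 fun x => by
      simpa using Finset.sum_le_card_nsmul (Finset.range n) _ (1 : ℝ) fun i _ =>
        indicator_le_self' (fun _ _ => zero_le_one) (T.iter i ω x : X)⟩
  exact ciSup_mono hbdd fun _ => Finset.sum_le_sum fun _ _ =>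
    indicator_le_indicator_of_subset h (fun _ => zero_le_one) _

theorem IsSmall.mono {E E' : Set X} (h : E ⊆ E') (hE' : T.IsSmall E') : T.IsSmall E := by
  filter_upwards [hE'] with ω hω
  refine squeeze_zero (fun n => ?_) (fun n => ?_) hω
  · exact mul_nonneg (by positivity) (maxVisits_nonneg E n ω)
  · exact mul_le_mul_of_nonneg_left (maxVisits_mono h n ω) (by positivity)

theorem maxVisits_le_fiberSup {E : Set X} {F : T.boundedMeasurable} (h0 : ∀ p, 0 ≤ F.1 p)
    (h1 : ∀ p, p.1.2 ∈ E → 1 ≤ F.1 p) (n : ℕ) (ω : Ω) :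
    T.maxVisits E n ω ≤ T.fiberSup ((∑ i ∈ Finset.range n, T.koopman ^ i) F).1 ω := by
  refine ciSup_le fun x => ?_
  refine le_trans ?_ (le_fiberSup ((∑ i ∈ Finset.range n, T.koopman ^ i) F) ⟨(ω, x), x.2⟩)
  rw [coe_sum_koopman_pow]
  refine Finset.sum_le_sum fun i _ => ?_
  have hsnd : (T.skew^[i] ⟨(ω, x), x.2⟩).1.2 = (T.iter i ω x : X) :=
    congrArg Prod.snd (T.skew_iterate i ω x)
  rw [← hsnd]
  exact indicator_le' (fun _ => h1 _) (fun _ _ => h0 _) _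

theorem mul_fiberSup_sum_koopman_le {F : T.boundedMeasurable} (hF : ∀ p, F.1 p ∈ Icc 0 1)
    (m n : ℕ) (ω : Ω) :
    m * T.fiberSup ((∑ i ∈ Finset.range n, T.koopman ^ i) F).1 ω ≤
      birkhoffSum ϑ (T.fiberSup ((∑ i ∈ Finset.range m, T.koopman ^ i) F).1) n ω + m ^ 2 := by
  rw [← fiberSup_smul m.cast_nonneg]
  refine fiberSup_le fun x hx => ?_
  rw [Pi.smul_apply, smul_eq_mul, coe_sum_koopman_pow]
  refine (mul_birkhoffSum_le T.skew hF m n _).trans (add_le_add_left ?_ _)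
  refine Finset.sum_le_sum fun i _ => ?_
  have hfst : (T.skew^[i] ⟨(ω, x), hx⟩).1.1 = ϑ^[i] ω :=
    congrArg Prod.fst (T.skew_iterate i ω ⟨x, hx⟩)
  rw [← hfst, ← coe_sum_koopman_pow]
  exact le_fiberSup _ _

end Visits

section UniquelyErgodic

variable {Ω : Type*} [MeasurableSpace Ω] {X : Type*} [MetricSpace X] [CompactSpace X]
  [MeasurableSpace X] [BorelSpace X] {P : Measure Ω} {ϑ : Ω → Ω} {T : BundleRDS X P ϑ}

theorem UniquelyErgodic.tendsto_supIntegral_div [IsProbabilityMeasure P]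
    (hT : T.UniquelyErgodic) {μ : Measure (Ω × X)} (hμ : μ ∈ T.invariantMeasures)
    {F : T.boundedMeasurable} (hF : T.IsFiberContinuous F.1) :
    Tendsto (fun n : ℕ => T.supIntegral ((∑ i ∈ Finset.range n, T.koopman ^ i) F) / n) atTop
      (𝓝 (∫ p : T.graph, F.1 p ∂μ.comap (↑))) := by
  obtain ⟨m, hm, hlim⟩ := exists_mem_invariantMeasures_tendsto hF
  obtain ⟨μ', hμ'⟩ := hT
  rw [hμ', mem_singleton_iff] at hμ hm
  rwa [hμ, ← hm]

theorem UniquelyErgodic.ae_exists_forall_maxVisits_le_of_integral_lt [IsProbabilityMeasure P]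
    (hT : T.UniquelyErgodic) (hP : Ergodic ϑ P) {μ : Measure (Ω × X)}
    (hμ : μ ∈ T.invariantMeasures) {E : Set X} {F : T.boundedMeasurable}
    (hF : T.IsFiberContinuous F.1) (h01 : ∀ p, F.1 p ∈ Icc 0 1)
    (hE : ∀ p, p.1.2 ∈ E → 1 ≤ F.1 p) {c : ℝ} (hc : ∫ p : T.graph, F.1 p ∂μ.comap (↑) < c) :
    ∀ᵐ ω ∂P, ∃ M, ∀ n : ℕ, T.maxVisits E n ω ≤ M + n * c := by
  have hlim := hT.tendsto_supIntegral_div hμ hF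
  obtain ⟨m, hm, hm0⟩ := ((hlim.eventually_lt_const hc).and (eventually_gt_atTop 0)).exists
  have hm0' : (0 : ℝ) < m := Nat.cast_pos.2 hm0
  rw [div_lt_iff₀ hm0'] at hm
  filter_upwards [ae_exists_forall_birkhoffSum_le hP (integrable_fiberSup _) hm] with ω ⟨M, hM⟩
  refine ⟨(M + m ^ 2) / m, fun n => le_of_mul_le_mul_left ?_ hm0'⟩
  calc m * T.maxVisits E n ω
      ≤ m * T.fiberSup ((∑ i ∈ Finset.range n, T.koopman ^ i) F).1 ω := by
        gcongr
        exact maxVisits_le_fiberSup (fun p => (h01 p).1) hE n ω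
    _ ≤ M + n * (c * m) + m ^ 2 :=
        (mul_fiberSup_sum_koopman_le h01 m n ω).trans (add_le_add_left (hM n) _)
    _ = m * ((M + m ^ 2) / m + n * c) := by field_simp; ring

theorem UniquelyErgodic.ae_exists_forall_maxVisits_le_of_measureReal_lt [IsProbabilityMeasure P]
    (hT : T.UniquelyErgodic) (hP : Ergodic ϑ P) {μ : Measure (Ω × X)}
    (hμ : μ ∈ T.invariantMeasures) {E : Set X} (hE : IsClosed E) {c : ℝ}
    (hc : μ.real (univ ×ˢ E) < c) :
    ∀ᵐ ω ∂P, ∃ M, ∀ n : ℕ, T.maxVisits E n ω ≤ M + n * c := by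
  have := hμ.1
  have hc' : (μ.map Prod.snd).real E < c := by
    rwa [map_measureReal_apply measurable_snd hE.measurableSet, ← univ_prod]
  obtain ⟨f, hf01, hfE, hfc⟩ := exists_continuous_integral_lt_of_measureReal_lt hE hc'
  rw [← integral_comap_graph_comp_snd hμ f.continuous.aestronglyMeasurable] at hfc
  exact hT.ae_exists_forall_maxVisits_le_of_integral_lt hP hμ
    (isFiberContinuous_ofSimpleFunc (.const Ω f)) (fun p => hf01 p.1.2)
    (fun p hp => (hfE p.1.2 hp).ge) hfc

theorem UniquelyErgodic.isSmall_of_isClosed_of_measure_eq_zero [IsProbabilityMeasure P]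
    (hT : T.UniquelyErgodic) (hP : Ergodic ϑ P) {μ : Measure (Ω × X)}
    (hμ : μ ∈ T.invariantMeasures) {E : Set X} (hE : IsClosed E)
    (hE0 : μ (univ ×ˢ E) = 0) : T.IsSmall E := by
  have hvisits : ∀ᵐ ω ∂P, ∀ k : ℕ, ∃ M, ∀ n : ℕ, T.maxVisits E n ω ≤ M + n * (1 / (k + 1)) :=
    ae_all_iff.2 fun k => hT.ae_exists_forall_maxVisits_le_of_measureReal_lt hP hμ hE (by
      rw [measureReal_def, hE0]
      exact Nat.one_div_pos_of_nat)
  filter_upwards [hvisits] with ω hω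
  refine tendsto_one_div_mul_of_forall_le_add_mul (fun n => maxVisits_nonneg E n ω) fun ε hε => ?_
  obtain ⟨k, hk⟩ := exists_nat_one_div_lt hε
  refine (hω k).imp fun M hM n => (hM n).trans ?_
  gcongr

theorem UniquelyErgodic.countable_setOf_not_isSmall_sphere [IsProbabilityMeasure P]
    (hT : T.UniquelyErgodic) (hP : Ergodic ϑ P) (x : X) :
    {r : ℝ | ¬ T.IsSmall (Metric.sphere x r)}.Countable := by
  obtain ⟨μ, hμ⟩ := hT.imp fun _ h => h ▸ mem_singleton _
  have := hμ.1
  refine (countable_setOf_measure_prod_sphere_ne_zero μ x).mono fun r => mt fun h0 => ?_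
  exact hT.isSmall_of_isClosed_of_measure_eq_zero hP hμ Metric.isClosed_sphere h0

end UniquelyErgodic

section SmallBalls

variable {Ω : Type*} [MeasurableSpace Ω] {X : Type*} [PseudoMetricSpace X] [MeasurableSpace X]
  {P : Measure Ω} {ϑ : Ω → Ω} {T : BundleRDS X P ϑ}

theorem exists_isSmall_frontier_ball {x : X}
    (hx : {r : ℝ | ¬ T.IsSmall (Metric.sphere x r)}.Countable) {ε : ℝ} (hε : 0 < ε) :
    ∃ r : ℝ, 0 < r ∧ r < ε ∧ T.IsSmall (frontier (Metric.ball x r)) := by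
  obtain ⟨r, hr, hr0, hrε⟩ := hx.dense_compl ℝ |>.exists_between hε
  exact ⟨r, hr0, hrε, IsSmall.mono Metric.frontier_ball_subset_sphere (not_not.1 hr)⟩

theorem hasSBP_of_forall_exists_isSmall_frontier_ball
    (h : ∀ x : X, ∀ ε : ℝ, 0 < ε →
      ∃ r : ℝ, 0 < r ∧ r < ε ∧ T.IsSmall (frontier (Metric.ball x r))) : T.HasSBP := by
  intro x U hU hx
  obtain ⟨ε, hε, hεU⟩ := Metric.isOpen_iff.1 hU x hx
  obtain ⟨r, hr, hrε, hsmall⟩ := h x ε hε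
  exact ⟨Metric.ball x r, Metric.ball_mem_nhds x hr,
    (Metric.ball_subset_ball hrε.le).trans hεU, hsmall⟩

end SmallBalls

end BundleRDS

theorem mainTheorem7_general {Ω : Type*} [MeasurableSpace Ω] {X : Type*} [MetricSpace X]
    [CompactSpace X] [MeasurableSpace X] [BorelSpace X]
    (P : Measure Ω) [IsProbabilityMeasure P] (ϑ : Ω → Ω)
    (T : BundleRDS X P ϑ) (hP : Ergodic ϑ P) (hT : T.UniquelyErgodic) :
    T.HasSBP ∧
      ∀ x : X,
        (∀ μ ∈ T.invariantMeasures,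
          {r : ℝ | 0 < r ∧ μ (Set.univ ×ˢ Metric.sphere x r) ≠ 0}.Countable) ∧
        {r : ℝ | 0 < r ∧ ¬ T.IsSmall (Metric.sphere x r)}.Countable ∧
        ∀ ε : ℝ, 0 < ε → ∃ r : ℝ, 0 < r ∧ r < ε ∧ T.IsSmall (frontier (Metric.ball x r)) := by
  have hsphere := hT.countable_setOf_not_isSmall_sphere hP
  have hball : ∀ x : X, ∀ ε : ℝ, 0 < ε →
      ∃ r : ℝ, 0 < r ∧ r < ε ∧ T.IsSmall (frontier (Metric.ball x r)) := fun x _ =>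
    BundleRDS.exists_isSmall_frontier_ball (hsphere x)
  refine ⟨BundleRDS.hasSBP_of_forall_exists_isSmall_frontier_ball hball, fun x =>
    ⟨fun μ hμ => ?_, (hsphere x).mono fun _ => And.right, hball x⟩⟩
  have := hμ.1
  exact (countable_setOf_measure_prod_sphere_ne_zero μ x).mono fun _ => And.right

theorem mainTheorem7 {Ω : Type*} [MeasurableSpace Ω] {X : Type*} [MetricSpace X]
    [CompactSpace X] [MeasurableSpace X] [BorelSpace X]
    (P : Measure Ω) [IsProbabilityMeasure P] [P.IsComplete] (ϑ : Ω → Ω)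
    (T : BundleRDS X P ϑ) (hP : Ergodic ϑ P) (hT : T.UniquelyErgodic) :
    T.HasSBP ∧
      ∀ x : X,
        (∀ μ ∈ T.invariantMeasures,
          {r : ℝ | 0 < r ∧ μ (Set.univ ×ˢ Metric.sphere x r) ≠ 0}.Countable) ∧
        {r : ℝ | 0 < r ∧ ¬ T.IsSmall (Metric.sphere x r)}.Countable ∧
        ∀ ε : ℝ, 0 < ε → ∃ r : ℝ, 0 < r ∧ r < ε ∧ T.IsSmall (frontier (Metric.ball x r)) :=
  mainTheorem7_general P ϑ T hP hT
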